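/- Fix $n\ge 3$ parties. A state is an (unnormalized) vector of $(\mathbb C^d)^{\otimes n}$; it is fully entangled if all its single-party reduced density matrices have full rank, and symmetric if it is invariant under exchanging any two parties. Two states are SLOCC-equivalent if one is the image of the other under $A_1\otimes\cdots\otimes A_n$ with all $A_i$ invertible, and LU-equivalent if, up to a nonzero scalar, the $A_i$ can be taken unitary. An LOCC$_{\mathbb N}$ transformation is a deterministic one by a protocol of finitely many rounds, in each of which one party performs a generalized measurement (chosen depending on all earlier outcomes) and announces the outcome; in an LOCC$_1$ transformation one party measures and the other parties apply local unitaries depending on the outcome. A state is weakly isolated if it can neither be obtained by LOCC$_{\mathbb N}$ from a fully entangled state of $(\mathbb C^d)^{\otimes n}$ that is not LU-equivalent to it, nor be converted by LOCC$_1$ into such a state. For $k\ge 0$ let $|E_k\rangle=\sum_{i_1+\dots+i_n=k}|i_1\dots i_n\rangle\in(\mathbb C^{k+1})^{\otimes n}$. For $k_1,\dots,k_K\ge 0$ let $\bigoplus_{b=1}^K|E_{k_b}\rangle\in\bigl(\bigoplus_{b=1}^K\mathbb C^{k_b+1}\bigr)^{\otimes n}$ be the sum of these states, each embedded through the $b$-th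 summand at every party. (1) If $K\ge 2$ and $k_b\ne 0$ for at least one $b$, then the SLOCC class of $\bigoplus_{b=1}^K|E_{k_b}\rangle$ contains a weakly isolated state. If, moreover, $k_b\ne 2$ for all $b$, then it contains a symmetric weakly isolated state. (2) Call an SLOCC class non-derogatory exceptionally symmetric (ES) if it contains a fully entangled symmetric state that is invariant under $B\otimes B^{-1}$ acting on two distinct parties, for some invertible $B\not\propto\mathbb 1$ all of whose eigenvalues have geometric multiplicity one. The classes of the $n$-qubit states $|0\cdots0\rangle+|1\cdots1\rangle$ (GHZ) and $|10\cdots0\rangle+|010\cdots0\rangle+\dots+|0\cdots01\rangle$ (W) are non-derogatory ES, and they are exactly the non-derogatory ES classes (of any local dimension $d$) that contain no weakly isolated state. -/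

import Mathlib

open scoped Matrix

noncomputable section

namespace MultipartiteLOCC

/-- An unnormalised pure state of `n` parties, each with local Hilbert space `ℂ^ι`, given by its
amplitudes in the computational product basis. -/
abbrev QState (n : ℕ) (ι : Type) : Type := (Fin n → ι) → ℂ

section Operators

variable {n : ℕ} {ι κ : Type} [Fintype ι] [DecidableEq ι] [Fintype κ] [DecidableEq κ]

/-- The action of the local operator `A 0 ⊗ ⋯ ⊗ A (n-1)` on a state. -/
def localOp (A : Fin n → Matrix κ ι ℂ) (Ψ : QState n ι) : QState n κ :=
  fun y => ∑ x : Fin n → ι, (∏ i, A i (y i) (x i)) * Ψ x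

/-- The action of a single operator `A` on party `i`, all other parties being left alone. -/
def actAt (i : Fin n) (A : Matrix ι ι ℂ) (Ψ : QState n ι) : QState n ι :=
  localOp (Function.update (fun _ => (1 : Matrix ι ι ℂ)) i A) Ψ

/-- The (unnormalised) reduced density matrix of party `i`. -/
def reducedDensity (Ψ : QState n ι) (i : Fin n) : Matrix ι ι ℂ :=
  fun a b => ∑ x : Fin n → ι, if x i = a then Ψ x * star (Ψ (Function.update x i b)) else 0

/-- A state is fully entangled if all single-party reduced density matrices have full rank. -/
def FullyEntangled (Ψ : QState n ι) : Prop :=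
  ∀ i, (reducedDensity Ψ i).rank = Fintype.card ι

/-- SLOCC equivalence: `Ψ = A 0 ⊗ ⋯ ⊗ A (n-1) Φ` with all `A i` invertible. The two families of
local basis labels may differ as types, in which case the `A i` are invertible matrices whose
rows and columns carry different labels. -/
def SLOCCEquivalent (Ψ : QState n κ) (Φ : QState n ι) : Prop :=
  ∃ (A : Fin n → Matrix κ ι ℂ) (A' : Fin n → Matrix ι κ ℂ),
    (∀ i, A i * A' i = 1 ∧ A' i * A i = 1) ∧ Ψ = localOp A Φ

/-- Equivalence under local unitaries, up to a nonzero scalar (states are unnormalised). -/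
def LUEquivalent (Ψ Φ : QState n ι) : Prop :=
  ∃ (U : Fin n → Matrix ι ι ℂ) (c : ℂ),
    (∀ i, U i ∈ Matrix.unitaryGroup ι ℂ) ∧ c ≠ 0 ∧ Ψ = c • localOp U Φ

/-- Permutation-symmetric states: invariant under the exchange of any two parties. -/
def IsSymmetric (Ψ : QState n ι) : Prop :=
  ∀ (i j : Fin n) (x : Fin n → ι), Ψ (x ∘ Equiv.swap i j) = Ψ x

/-- The completeness relation for the operators of a generalised measurement. -/
def IsMeasurement {m : ℕ} (A : Fin m → Matrix ι ι ℂ) : Prop :=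
  ∑ k, (A k)ᴴ * A k = 1

/-- `FiniteRoundLOCC Φ Ψ`: there is an LOCC protocol with finitely many rounds that transforms
`Ψ` into `Φ` with certainty. In each round some party performs a generalised measurement, and
the continuation of the protocol may depend on the outcome, which is announced to everybody.
Measurements with a single outcome are local unitaries. Outcomes of probability zero are
irrelevant. -/
inductive FiniteRoundLOCC (Φ : QState n ι) : QState n ι → Prop
  | done {Ψ : QState n ι} (c : ℂ) (hc : c ≠ 0) (h : Ψ = c • Φ) : FiniteRoundLOCC Φ Ψ
  | round {Ψ : QState n ι} (i : Fin n) (m : ℕ) (A : Fin m → Matrix ι ι ℂ)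
      (hA : IsMeasurement A)
      (h : ∀ k, actAt i (A k) Ψ ≠ 0 → FiniteRoundLOCC Φ (actAt i (A k) Ψ)) :
      FiniteRoundLOCC Φ Ψ

/-- `OneRoundLOCC Ψ Φ`: one party `i` measures, and, depending on the outcome `k`, the other
parties apply local unitaries, such that every outcome yields `Φ` (up to a scalar, which is
zero exactly for outcomes of probability zero). -/
def OneRoundLOCC (Ψ Φ : QState n ι) : Prop :=
  ∃ (i : Fin n) (m : ℕ) (A : Fin m → Matrix ι ι ℂ) (U : Fin m → Fin n → Matrix ι ι ℂ)
    (c : Fin m → ℂ),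
    IsMeasurement A ∧ (∀ k j, U k j ∈ Matrix.unitaryGroup ι ℂ) ∧
      ∀ k, localOp (Function.update (U k) i (A k)) Ψ = c k • Φ

/-- `Φ` can be reached by a finite-round LOCC protocol from a fully entangled state that is
not related to `Φ` by local unitaries. -/
def Reachable (Φ : QState n ι) : Prop :=
  ∃ Ψ : QState n ι, FullyEntangled Ψ ∧ ¬ LUEquivalent Ψ Φ ∧ FiniteRoundLOCC Φ Ψ

/-- `Ψ` can be converted by a one-round LOCC protocol into a fully entangled state that is
not related to `Ψ` by local unitaries. -/
def Convertible (Ψ : QState n ι) : Prop :=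
  ∃ Φ : QState n ι, FullyEntangled Φ ∧ ¬ LUEquivalent Ψ Φ ∧ OneRoundLOCC Ψ Φ

/-- Weakly isolated states: neither reachable by finite-round LOCC nor convertible by
one-round LOCC. -/
def WeaklyIsolated (Ψ : QState n ι) : Prop :=
  ¬ Reachable Ψ ∧ ¬ Convertible Ψ

/-- A matrix is non-derogatory if each of its eigenvalues has geometric multiplicity one. -/
def IsNonderogatory (B : Matrix ι ι ℂ) : Prop :=
  ∀ μ : ℂ, Module.finrank ℂ (Module.End.eigenspace (Matrix.toLin' B) μ) ≤ 1

/-- The SLOCC class of `Ψ` is a non-derogatory exceptionally symmetric class: it contains a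
fully entangled symmetric state that is stabilised by some `B ⊗ B⁻¹` (acting on two distinct
parties) with `B` invertible, not a multiple of the identity, and non-derogatory. -/
def InNonderogatoryESClass (Ψ : QState n ι) : Prop :=
  ∃ Φ : QState n ι, SLOCCEquivalent Φ Ψ ∧ FullyEntangled Φ ∧ IsSymmetric Φ ∧
    ∃ B : Matrix ι ι ℂ, IsUnit B ∧ (∀ c : ℂ, B ≠ c • (1 : Matrix ι ι ℂ)) ∧ IsNonderogatory B ∧
      ∃ i j : Fin n, i ≠ j ∧
        localOp (Function.update (Function.update (fun _ => (1 : Matrix ι ι ℂ)) i B) j B⁻¹) Φ = Φ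

end Operators

/-- The state `|E_k⟩ = ∑_{i₁ + ⋯ + iₙ = k} |i₁ ⋯ iₙ⟩` with local dimension `k + 1`. -/
def excitationState (n k : ℕ) : QState n (Fin (k + 1)) :=
  fun x => if ∑ i, (x i : ℕ) = k then 1 else 0

/-- The direct sum of states `Ψ b`, in which the local basis vector `a` of block `b` becomes
the local basis vector `⟨b, a⟩`. -/
def directSum {n K : ℕ} {ι : Fin K → Type} [∀ b, Fintype (ι b)] [∀ b, DecidableEq (ι b)]
    (Ψ : ∀ b, QState n (ι b)) : QState n (Σ b, ι b) :=
  ∑ b, ∑ y : Fin n → ι b, Ψ b y • Pi.single (fun i => (⟨b, y i⟩ : Σ b, ι b)) (1 : ℂ)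

/-- The state `⊕_b |E_{k_b}⟩`. -/
def blockState (n : ℕ) {K : ℕ} (k : Fin K → ℕ) : QState n (Σ b, Fin (k b + 1)) :=
  directSum fun b => excitationState n (k b)

/-- The qubit GHZ state `|0⋯0⟩ + |1⋯1⟩`. -/
def qubitGHZ (n : ℕ) : QState n (Fin 2) :=
  Pi.single (fun _ => 0) 1 + Pi.single (fun _ => 1) 1

/-- The (unnormalised) qubit W state `|10⋯0⟩ + |010⋯0⟩ + ⋯ + |0⋯01⟩`. -/
def qubitW (n : ℕ) : QState n (Fin 2) :=
  ∑ i : Fin n, Pi.single (Pi.single i 1) 1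

end MultipartiteLOCC

end

open MultipartiteLOCC

noncomputable section

namespace MultipartiteLOCC

open scoped ComplexOrder

set_option linter.unusedSectionVars false

section Basics

variable {n : ℕ} {ι κ τ : Type} [Fintype ι] [DecidableEq ι] [Fintype κ] [DecidableEq κ]
  [Fintype τ] [DecidableEq τ]

/-- The tensor product of a family of matrices. -/
def kron (A : Fin n → Matrix κ ι ℂ) : Matrix (Fin n → κ) (Fin n → ι) ℂ :=
  fun y x => ∏ i, A i (y i) (x i)

lemma localOp_eq_mulVec (A : Fin n → Matrix κ ι ℂ) (Ψ : QState n ι) :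
    localOp A Ψ = kron A *ᵥ Ψ := rfl

lemma kron_mul (A : Fin n → Matrix τ κ ℂ) (B : Fin n → Matrix κ ι ℂ) :
    kron A * kron B = kron fun i => A i * B i := by
  ext z x
  simp only [kron, Matrix.mul_apply, ← Finset.prod_mul_distrib]
  rw [Finset.prod_univ_sum, Fintype.piFinset_univ]

lemma kron_one : kron (fun _ : Fin n => (1 : Matrix ι ι ℂ)) = 1 := by
  ext y x
  simp only [kron, Matrix.one_apply]
  rw [Finset.prod_ite_zero]
  simp [funext_iff]

lemma kron_conjTranspose (A : Fin n → Matrix κ ι ℂ) :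
    (kron A)ᴴ = kron fun i => (A i)ᴴ := by
  ext x y
  simp [kron, Matrix.conjTranspose_apply]

lemma localOp_localOp (A : Fin n → Matrix τ κ ℂ) (B : Fin n → Matrix κ ι ℂ) (Ψ : QState n ι) :
    localOp A (localOp B Ψ) = localOp (fun i => A i * B i) Ψ := by
  simp only [localOp_eq_mulVec, Matrix.mulVec_mulVec, kron_mul]

@[simp] lemma localOp_one (Ψ : QState n ι) :
    localOp (fun _ => (1 : Matrix ι ι ℂ)) Ψ = Ψ := by
  simp [localOp_eq_mulVec, kron_one]

@[simp] lemma localOp_smul (A : Fin n → Matrix κ ι ℂ) (c : ℂ) (Ψ : QState n ι) :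
    localOp A (c • Ψ) = c • localOp A Ψ := by
  simp [localOp_eq_mulVec, Matrix.mulVec_smul]

lemma localOp_update_smul (A : Fin n → Matrix κ ι ℂ) (i : Fin n) (M : Matrix κ ι ℂ) (c : ℂ)
    (Ψ : QState n ι) :
    localOp (Function.update A i (c • M)) Ψ = c • localOp (Function.update A i M) Ψ := by
  ext y
  simp only [localOp, Pi.smul_apply, smul_eq_mul, Finset.mul_sum]
  refine Finset.sum_congr rfl fun x _ => ?_
  rw [← Finset.mul_prod_erase _ _ (Finset.mem_univ i),
    ← Finset.mul_prod_erase (a := i) _ (fun j => Function.update A i M j (y j) (x j))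
      (Finset.mem_univ i)]
  have : ∀ N : Matrix κ ι ℂ, ∏ j ∈ Finset.univ.erase i, Function.update A i N j (y j) (x j)
      = ∏ j ∈ Finset.univ.erase i, A j (y j) (x j) := fun N =>
    Finset.prod_congr rfl fun j hj => by
      rw [Function.update_of_ne (Finset.ne_of_mem_erase hj)]
  simp only [this, Function.update_self, Matrix.smul_apply, smul_eq_mul]
  ring

lemma localOp_update_zero (A : Fin n → Matrix κ ι ℂ) (i : Fin n) (Ψ : QState n ι) :
    localOp (Function.update A i 0) Ψ = 0 := by
  have := localOp_update_smul A i 0 0 Ψ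
  simpa using this

/-- The state as a matrix: rows are labelled by the basis of party `i`. -/
def slice (Ψ : QState n ι) (i : Fin n) : Matrix ι (Fin n → ι) ℂ :=
  fun a x => Ψ (Function.update x i a)

/-- The reduced density matrix of party `i`, times the local dimension. -/
def gram (Ψ : QState n ι) (i : Fin n) : Matrix ι ι ℂ := slice Ψ i * (slice Ψ i)ᴴ

lemma sum_update (f : (Fin n → ι) → ℂ) (i : Fin n) (a : ι) :
    ∑ x, f (Function.update x i a) = Fintype.card ι * ∑ x, if x i = a then f x else 0 := by
  have h : ∀ b : ι, (∑ x : Fin n → ι, if x i = b then f (Function.update x i a) else 0) =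
      ∑ x : Fin n → ι, if x i = a then f x else 0 := by
    intro b
    rw [← Finset.sum_filter, ← Finset.sum_filter]
    refine Finset.sum_bij' (fun x _ => Function.update x i a) (fun x _ => Function.update x i b)
      ?_ ?_ ?_ ?_ ?_
    · intro x _; simp
    · intro x _; simp
    · intro x hx
      simp only [Finset.mem_filter, Finset.mem_univ, true_and] at hx
      simp [← hx]
    · intro x hx
      simp only [Finset.mem_filter, Finset.mem_univ, true_and] at hx
      simp [← hx]
    · intro x _; rfl
  calc ∑ x, f (Function.update x i a)
      = ∑ x : Fin n → ι, ∑ b : ι, if x i = b then f (Function.update x i a) else 0 := by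
        simp
    _ = ∑ b : ι, ∑ x : Fin n → ι, if x i = b then f (Function.update x i a) else 0 :=
        Finset.sum_comm
    _ = _ := by simp [h]

lemma gram_eq (Ψ : QState n ι) (i : Fin n) :
    gram Ψ i = (Fintype.card ι : ℂ) • reducedDensity Ψ i := by
  ext a b
  simp only [gram, slice, Matrix.mul_apply, Matrix.conjTranspose_apply, Matrix.smul_apply,
    reducedDensity, smul_eq_mul]
  rw [← sum_update (fun x => Ψ x * star (Ψ (Function.update x i b))) i a]
  simp

lemma rank_gram (Ψ : QState n ι) (i : Fin n) : (gram Ψ i).rank = (reducedDensity Ψ i).rank := by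
  rcases isEmpty_or_nonempty ι with h | h
  · rw [Subsingleton.elim (gram Ψ i) (reducedDensity Ψ i)]
  · rw [gram_eq]
    exact Matrix.rank_smul_of_mem_nonZeroDivisors _
      (mem_nonZeroDivisors_of_ne_zero (Nat.cast_ne_zero.2 Fintype.card_ne_zero))

/-- Full entanglement as injectivity of the contraction with each party. -/
lemma fullyEntangled_iff (Ψ : QState n ι) :
    FullyEntangled Ψ ↔
      ∀ i (v : ι → ℂ), (∀ x, ∑ a, v a * Ψ (Function.update x i a) = 0) → v = 0 := by
  refine forall_congr' fun i => ?_
  rw [← rank_gram, gram, Matrix.rank_self_mul_conjTranspose]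
  have h1 : (slice Ψ i).rank = Fintype.card ι ↔ LinearIndependent ℂ (slice Ψ i).row := by
    rw [linearIndependent_iff_card_eq_finrank_span, Matrix.rank_eq_finrank_span_row,
      eq_comm]
    rfl
  rw [h1, ← Matrix.vecMul_injective_iff]
  rw [← Matrix.coe_vecMulLinear, ← LinearMap.ker_eq_bot, LinearMap.ker_eq_bot']
  refine forall_congr' fun v => ?_
  rw [Matrix.vecMulLinear_apply, funext_iff]
  rfl

lemma gram_posDef {Ψ : QState n ι} (h : FullyEntangled Ψ) (i : Fin n) : (gram Ψ i).PosDef := by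
  refine Matrix.PosDef.mul_conjTranspose_self _ ?_
  rw [← Matrix.coe_vecMulLinear, ← LinearMap.ker_eq_bot, LinearMap.ker_eq_bot']
  intro v hv
  refine (fullyEntangled_iff Ψ).1 h i v fun x => ?_
  exact congrFun hv x

lemma slice_localOp_update (A : Fin n → Matrix ι ι ℂ) (i : Fin n) (Ψ : QState n ι) :
    slice (localOp A Ψ) i = A i * slice Ψ i * (kron (Function.update A i 1))ᵀ := by
  have h1 : slice (localOp (Function.update A i 1) Ψ) i
      = slice Ψ i * (kron (Function.update A i 1))ᵀ := by
    ext a x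
    simp only [slice, Matrix.mul_apply, Matrix.transpose_apply, localOp, kron]
    have key : ∀ (y z : Fin n → ι), ∏ j, Function.update A i 1 j (y j) (z j)
        = (1 : Matrix ι ι ℂ) (y i) (z i) * ∏ j ∈ Finset.univ.erase i, A j (y j) (z j) := by
      intro y z
      rw [← Finset.mul_prod_erase _ _ (Finset.mem_univ i), Function.update_self]
      congr 1
      exact Finset.prod_congr rfl fun j hj => by
        rw [Function.update_of_ne (Finset.ne_of_mem_erase hj)]
    simp only [key, Function.update_self, Matrix.one_apply]
    have key2 : ∀ (z : Fin n → ι), ∏ j ∈ Finset.univ.erase i, A j (Function.update x i a j) (z j)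
        = ∏ j ∈ Finset.univ.erase i, A j (x j) (z j) := fun z =>
      Finset.prod_congr rfl fun j hj => by
        rw [Function.update_of_ne (Finset.ne_of_mem_erase hj)]
    simp only [key2, ite_mul, one_mul, zero_mul, mul_ite, mul_zero]
    rw [← Finset.sum_filter, ← Finset.sum_filter]
    refine Finset.sum_bij' (fun z _ => Function.update z i (x i)) (fun z _ => Function.update z i a)
      ?_ ?_ ?_ ?_ ?_
    · intro z _; simp
    · intro z _; simp
    · intro z hz
      simp only [Finset.mem_filter, Finset.mem_univ, true_and] at hz
      simp [hz]
    · intro z hz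
      simp only [Finset.mem_filter, Finset.mem_univ, true_and] at hz
      simp [hz]
    · intro z hz
      simp only [Finset.mem_filter, Finset.mem_univ, true_and] at hz
      rw [mul_comm]
      congr 1
      · simp [hz]
      · exact Finset.prod_congr rfl fun j hj => by
          rw [Function.update_of_ne (Finset.ne_of_mem_erase hj)]
  have h2 : ∀ (M : Matrix ι ι ℂ) (Φ : QState n ι), slice (actAt i M Φ) i = M * slice Φ i := by
    intro M Φ
    ext a x
    simp only [slice, actAt, Matrix.mul_apply, localOp]
    have key : ∀ (y z : Fin n → ι),
        ∏ j, Function.update (fun _ => (1 : Matrix ι ι ℂ)) i M j (y j) (z j)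
        = M (y i) (z i) * if z = Function.update y i (z i) then 1 else 0 := by
      intro y z
      rw [← Finset.mul_prod_erase _ _ (Finset.mem_univ i), Function.update_self]
      congr 1
      rw [Finset.prod_congr rfl (g := fun j => if y j = z j then (1 : ℂ) else 0)
        (fun j hj => by
          rw [Function.update_of_ne (Finset.ne_of_mem_erase hj), Matrix.one_apply]),
        Finset.prod_ite_zero]
      simp only [Finset.prod_const_one]
      congr 1
      simp only [Function.eq_update_iff, Finset.mem_erase, Finset.mem_univ, and_true, true_and,
        eq_comm]
    simp only [key, Function.update_self, Function.update_idem]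
    simp only [mul_ite, mul_one, mul_zero, ite_mul, zero_mul]
    rw [← Finset.sum_filter]
    refine Finset.sum_bij' (fun z _ => z i) (fun b _ => Function.update x i b) ?_ ?_ ?_ ?_ ?_
    · intro z _; simp
    · intro z _; simp
    · intro z hz
      simp only [Finset.mem_filter, Finset.mem_univ, true_and] at hz
      exact hz.symm
    · intro z _; simp
    · intro z hz
      simp only [Finset.mem_filter, Finset.mem_univ, true_and] at hz
      rw [← hz]
  have h3 : localOp A Ψ = actAt i (A i) (localOp (Function.update A i 1) Ψ) := by
    rw [actAt, localOp_localOp]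
    congr 1
    ext1 j
    by_cases hj : j = i
    · subst hj; simp
    · simp [hj]
  rw [h3, h2, h1, Matrix.mul_assoc]

lemma kron_unitary {A : Fin n → Matrix ι ι ℂ} (h : ∀ j, A j ∈ Matrix.unitaryGroup ι ℂ) :
    (kron A)ᵀ * ((kron A)ᵀ)ᴴ = 1 := by
  have : (kron A)ᴴ * kron A = 1 := by
    rw [kron_conjTranspose, kron_mul, ← kron_one]
    congr 1
    ext1 j
    exact Matrix.mem_unitaryGroup_iff'.1 (h j)
  have h2 := congrArg Matrix.transpose this
  rwa [Matrix.transpose_mul, Matrix.transpose_one] at h2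

lemma gram_localOp {A : Fin n → Matrix ι ι ℂ} {i : Fin n}
    (h : ∀ j, j ≠ i → A j ∈ Matrix.unitaryGroup ι ℂ) (Ψ : QState n ι) :
    gram (localOp A Ψ) i = A i * gram Ψ i * (A i)ᴴ := by
  have hu : ∀ j, Function.update A i 1 j ∈ Matrix.unitaryGroup ι ℂ := by
    intro j
    by_cases hj : j = i
    · subst hj; simp [one_mem]
    · simpa [hj] using h j hj
  have hk := kron_unitary hu
  rw [gram, slice_localOp_update, gram]
  simp only [Matrix.conjTranspose_mul, Matrix.mul_assoc]
  congr 2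
  rw [← Matrix.mul_assoc _ _ (_ * _), hk, Matrix.one_mul]

lemma gram_smul (c : ℂ) (Ψ : QState n ι) (i : Fin n) :
    gram (c • Ψ) i = (c * star c) • gram Ψ i := by
  have : slice (c • Ψ) i = c • slice Ψ i := rfl
  rw [gram, this, gram, Matrix.conjTranspose_smul]
  simp [smul_smul, mul_comm]

end Basics

section WeakIsolation

variable {n : ℕ} {ι : Type} [Fintype ι] [DecidableEq ι]

lemma fullyEntangled_iff_rank (Ψ : QState n ι) :
    FullyEntangled Ψ ↔ ∀ i, (slice Ψ i).rank = Fintype.card ι := by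
  refine forall_congr' fun i => ?_
  rw [← rank_gram, gram, Matrix.rank_self_mul_conjTranspose]

lemma isUnit_kron {A : Fin n → Matrix ι ι ℂ} (h : ∀ j, IsUnit (A j)) : IsUnit (kron A) := by
  have h1 : kron A * kron (fun i => (A i)⁻¹) = 1 := by
    rw [kron_mul, ← kron_one]
    congr 1
    ext1 j
    exact Matrix.mul_nonsing_inv _ ((Matrix.isUnit_iff_isUnit_det _).1 (h j))
  exact IsUnit.of_mul_eq_one _ h1

lemma isUnit_of_mem_unitaryGroup {U : Matrix ι ι ℂ} (h : U ∈ Matrix.unitaryGroup ι ℂ) :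
    IsUnit U :=
  IsUnit.of_mul_eq_one _ (Matrix.mem_unitaryGroup_iff.1 h)

lemma FullyEntangled.localOp {Ψ : QState n ι} (h : FullyEntangled Ψ) {A : Fin n → Matrix ι ι ℂ}
    (hA : ∀ j, IsUnit (A j)) : FullyEntangled (localOp A Ψ) := by
  rw [fullyEntangled_iff_rank] at h ⊢
  intro i
  have hk : IsUnit (kron (Function.update A i 1)) := isUnit_kron fun j => by
    by_cases hj : j = i
    · subst hj; simp
    · simpa [hj] using hA j
  rw [slice_localOp_update, Matrix.rank_mul_eq_left_of_isUnit_det,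
    Matrix.rank_mul_eq_right_of_isUnit_det, h i]
  · exact (Matrix.isUnit_iff_isUnit_det _).1 (hA i)
  · rw [Matrix.det_transpose]
    exact (Matrix.isUnit_iff_isUnit_det _).1 hk

lemma FullyEntangled.of_localOp {Ψ : QState n ι} {A : Fin n → Matrix ι ι ℂ}
    (h : FullyEntangled (MultipartiteLOCC.localOp A Ψ)) :
    (∀ j, IsUnit (A j)) ∧ FullyEntangled Ψ := by
  rw [fullyEntangled_iff_rank] at h
  have h1 : ∀ i, Fintype.card ι ≤ (A i * slice Ψ i).rank := by
    intro i
    rw [← h i, slice_localOp_update]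
    exact Matrix.rank_mul_le_left _ _
  refine ⟨fun j => ?_, (fullyEntangled_iff_rank Ψ).2 fun j => ?_⟩
  · have h2 := (h1 j).trans (Matrix.rank_mul_le_left _ _)
    have h3 : (A j).rank = Fintype.card ι := le_antisymm (Matrix.rank_le_card_width _) h2
    have h4 : LinearIndependent ℂ (A j).row := by
      rw [linearIndependent_iff_card_eq_finrank_span, ← h3, Matrix.rank_eq_finrank_span_row]
      rfl
    exact Matrix.linearIndependent_rows_iff_isUnit.1 h4
  · exact le_antisymm (Matrix.rank_le_card_height _) ((h1 j).trans (Matrix.rank_mul_le_right _ _))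

lemma slice_actAt (i : Fin n) (M : Matrix ι ι ℂ) (Ψ : QState n ι) :
    slice (actAt i M Ψ) i = M * slice Ψ i := by
  rw [actAt, slice_localOp_update, Function.update_self, Function.update_idem]
  rw [show Function.update (fun _ : Fin n => (1 : Matrix ι ι ℂ)) i 1 = fun _ => 1 by simp]
  simp [kron_one]

lemma FullyEntangled.mul_slice_cancel {Ψ : QState n ι} (h : FullyEntangled Ψ) {i : Fin n}
    {A A' : Matrix ι ι ℂ} (hA : A * slice Ψ i = A' * slice Ψ i) : A = A' := by
  rw [fullyEntangled_iff] at h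
  rw [← sub_eq_zero, ← Matrix.sub_mul] at hA
  rw [← sub_eq_zero]
  ext a b
  exact congrFun (h i ((A - A') a) fun x => congrFun (congrFun hA a) x) b

lemma FullyEntangled.localOp_cancel {Ψ : QState n ι} (h : FullyEntangled Ψ) {i : Fin n}
    {U : Fin n → Matrix ι ι ℂ} (hU : ∀ j, j ≠ i → IsUnit (U j)) {A A' : Matrix ι ι ℂ}
    (hA : MultipartiteLOCC.localOp (Function.update U i A) Ψ =
      MultipartiteLOCC.localOp (Function.update U i A') Ψ) : A = A' := by
  refine h.mul_slice_cancel (i := i) ?_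
  have h1 := congrArg (fun Φ => slice Φ i) hA
  simp only [slice_localOp_update, Function.update_self, Function.update_idem] at h1
  have hk : IsUnit (kron (Function.update U i 1)) := isUnit_kron fun j => by
    by_cases hj : j = i
    · subst hj; simp
    · simpa [hj] using hU j hj
  have hk' : IsUnit (kron (Function.update U i 1))ᵀ := by
    rwa [Matrix.isUnit_transpose]
  have h2 := congrArg (fun M => M * ((kron (Function.update U i 1))ᵀ)⁻¹) h1
  simpa only [Matrix.mul_assoc, Matrix.mul_nonsing_inv _
    ((Matrix.isUnit_iff_isUnit_det _).1 hk'), Matrix.mul_one] using h2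

lemma localOp_inv {A : Fin n → Matrix ι ι ℂ} (hA : ∀ j, IsUnit (A j)) (Ψ : QState n ι) :
    localOp (fun j => (A j)⁻¹) (localOp A Ψ) = Ψ := by
  rw [localOp_localOp]
  conv_rhs => rw [← localOp_one Ψ]
  congr 1
  ext1 j
  exact Matrix.nonsing_inv_mul _ ((Matrix.isUnit_iff_isUnit_det _).1 (hA j))

lemma unitary_inv {U : Matrix ι ι ℂ} (h : U ∈ Matrix.unitaryGroup ι ℂ) :
    U⁻¹ ∈ Matrix.unitaryGroup ι ℂ := by
  have : U⁻¹ = star U := Matrix.inv_eq_left_inv (Matrix.mem_unitaryGroup_iff'.1 h)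
  rw [this]
  exact Unitary.star_mem h

lemma luEquivalent_of_localOp {Ψ Φ : QState n ι} {U : Fin n → Matrix ι ι ℂ}
    (hU : ∀ j, U j ∈ Matrix.unitaryGroup ι ℂ) {i : Fin n} {t c : ℂ} (ht : t ≠ 0) (hc : c ≠ 0)
    {A : Matrix ι ι ℂ} (hA : A = t • U i)
    (h : localOp (Function.update U i A) Ψ = c • Φ) : LUEquivalent Ψ Φ := by
  rw [hA, localOp_update_smul, Function.update_eq_self] at h
  refine ⟨fun j => (U j)⁻¹, c / t, fun j => unitary_inv (hU j), div_ne_zero hc ht, ?_⟩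
  have h1 := congrArg (fun X => t⁻¹ • localOp (fun j => (U j)⁻¹) X) h
  simp only [localOp_smul, smul_smul, inv_mul_cancel₀ ht, one_smul,
    localOp_inv fun j => isUnit_of_mem_unitaryGroup (hU j)] at h1
  rw [h1, div_eq_inv_mul]

lemma exists_unitary_of_smul_conjTranspose_mul [Nonempty ι] {A : Matrix ι ι ℂ} {r : ℝ}
    (hr : 0 ≤ r) (h : (r : ℂ) • (Aᴴ * A) = 1) :
    ∃ U ∈ Matrix.unitaryGroup ι ℂ, ∃ t : ℂ, t ≠ 0 ∧ A = t • U := by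
  have hr0 : r ≠ 0 := by
    rintro rfl
    simp at h
  have hs : Real.sqrt r ≠ 0 := (Real.sqrt_ne_zero hr).2 hr0
  have hs' : (Real.sqrt r : ℂ) ≠ 0 := by exact_mod_cast hs
  refine ⟨(Real.sqrt r : ℂ) • A, ?_, (Real.sqrt r : ℂ)⁻¹, inv_ne_zero hs', ?_⟩
  · rw [Matrix.mem_unitaryGroup_iff', Matrix.star_eq_conjTranspose, Matrix.conjTranspose_smul,
      Matrix.smul_mul, Matrix.mul_smul, smul_smul, ← h]
    congr 1
    have := Real.mul_self_sqrt hr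
    simp only [Complex.star_def, Complex.conj_ofReal]
    exact_mod_cast this
  · rw [smul_smul, inv_mul_cancel₀ hs', one_smul]

/-- All local symmetries of `Φ` (up to scalars) that are unitary at all parties but `i` act as a
scalar at party `i`. -/
def QuasiUnitarilyRigid (Φ : QState n ι) : Prop :=
  ∀ (i : Fin n) (S : Fin n → Matrix ι ι ℂ) (c : ℂ), c ≠ 0 →
    (∀ j, j ≠ i → S j ∈ Matrix.unitaryGroup ι ℂ) → localOp S Φ = c • Φ → ∃ z : ℂ, S i = z • 1

lemma nonempty_of_ne_zero [NeZero n] {Ψ : QState n ι} (h : Ψ ≠ 0) : Nonempty ι := by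
  by_contra hι
  rw [not_nonempty_iff] at hι
  exact h (funext fun x => isEmptyElim (x 0))

/-- If every measurement operator is, up to unitaries, a multiple of `A₀`, then `A₀` is a
multiple of a unitary. -/
lemma IsMeasurement.exists_unitary [Nonempty ι] {m : ℕ} {A : Fin m → Matrix ι ι ℂ}
    (hA : IsMeasurement A) {A₀ : Matrix ι ι ℂ}
    (h : ∀ l, ∃ z : ℂ, ∃ V ∈ Matrix.unitaryGroup ι ℂ, A l = z • (V * A₀)) :
    ∃ U ∈ Matrix.unitaryGroup ι ℂ, ∃ t : ℂ, t ≠ 0 ∧ A₀ = t • U := by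
  choose z V hV hz using h
  refine exists_unitary_of_smul_conjTranspose_mul (r := ∑ l, ‖z l‖ ^ 2) (by positivity) ?_
  rw [← hA]
  push_cast
  rw [Finset.sum_smul]
  refine Finset.sum_congr rfl fun l _ => ?_
  rw [hz l, Matrix.conjTranspose_smul, Matrix.conjTranspose_mul, Matrix.smul_mul, Matrix.mul_smul,
    smul_smul, Matrix.mul_assoc, ← Matrix.mul_assoc _ (V l), ← Matrix.star_eq_conjTranspose (V l),
    Matrix.mem_unitaryGroup_iff'.1 (hV l), Matrix.one_mul, ← Complex.conj_mul']
  rfl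

lemma IsMeasurement.exists_ne_zero [Nonempty ι] {m : ℕ} {A : Fin m → Matrix ι ι ℂ}
    (hA : IsMeasurement A) : ∃ k, A k ≠ 0 := by
  by_contra! h
  simp [IsMeasurement, h] at hA

lemma QuasiUnitarilyRigid.luEquivalent_of_finiteRoundLOCC [NeZero n] {Φ Ψ : QState n ι}
    (hr : QuasiUnitarilyRigid Φ) (hΦ : FullyEntangled Φ) (h : FiniteRoundLOCC Φ Ψ) (h0 : Ψ ≠ 0) :
    LUEquivalent Ψ Φ := by
  induction h with
  | done c hc h => exact ⟨fun _ => 1, c, fun _ => one_mem _, hc, by simpa using h⟩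
  | @round Ψ i m A hA _ ih =>
    have : Nonempty ι := nonempty_of_ne_zero h0
    obtain ⟨k, hk⟩ : ∃ k, actAt i (A k) Ψ ≠ 0 := by
      by_contra! hall
      have hs : ∀ k, A k * slice Ψ i = 0 := by
        intro k
        rw [← slice_actAt, hall k]
        rfl
      have hz : slice Ψ i = 0 := by
        rw [← Matrix.one_mul (slice Ψ i), ← hA, Matrix.sum_mul]
        exact Finset.sum_eq_zero fun k _ => by rw [Matrix.mul_assoc, hs k, Matrix.mul_zero]
      apply h0
      ext x
      have := congrFun (congrFun hz (x i)) x
      simpa [slice] using this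
    obtain ⟨U, c, hU, hc, hE⟩ := ih k hk hk
    have hFE : FullyEntangled (actAt i (A k) Ψ) := by
      rw [hE, ← localOp_smul]
      refine FullyEntangled.localOp ?_ fun j => isUnit_of_mem_unitaryGroup (hU j)
      rw [fullyEntangled_iff] at hΦ ⊢
      intro i v hv
      refine hΦ i v fun x => ?_
      have := hv x
      simp only [Pi.smul_apply, smul_eq_mul, mul_left_comm _ c] at this
      rw [← Finset.mul_sum] at this
      exact (mul_eq_zero.1 this).resolve_left hc
    obtain ⟨hunit, hΨ⟩ := hFE.of_localOp
    have hAk : IsUnit (A k) := by simpa using hunit i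
    have hAk' := (Matrix.isUnit_iff_isUnit_det _).1 hAk
    have hall : ∀ l, ∃ z : ℂ, ∃ V ∈ Matrix.unitaryGroup ι ℂ, A l = z • (V * A k) := by
      intro l
      by_cases hl : actAt i (A l) Ψ = 0
      · refine ⟨0, 1, one_mem _, ?_⟩
        rw [zero_smul]
        refine hΨ.mul_slice_cancel (i := i) ?_
        rw [← slice_actAt, hl, Matrix.zero_mul]
        rfl
      obtain ⟨V, d, hV, hd, hE'⟩ := ih l hl hl
      have hS : localOp (fun j => (V j)⁻¹ *
          (Function.update (fun _ => 1) i (A l * (A k)⁻¹) j * U j)) Φ = (d / c) • Φ := by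
        rw [← localOp_localOp, ← localOp_localOp]
        have e1 : localOp U Φ = c⁻¹ • actAt i (A k) Ψ := by
          rw [hE, smul_smul, inv_mul_cancel₀ hc, one_smul]
        have e2 : localOp (Function.update (fun _ => 1) i (A l * (A k)⁻¹)) (actAt i (A k) Ψ)
            = actAt i (A l) Ψ := by
          rw [actAt, localOp_localOp, actAt]
          congr 1
          ext1 j
          by_cases hj : j = i
          · subst hj
            simp [Matrix.mul_assoc, Matrix.nonsing_inv_mul _ hAk']
          · simp [hj]
        rw [e1, localOp_smul, e2, hE', localOp_smul, localOp_smul,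
          localOp_inv fun j => isUnit_of_mem_unitaryGroup (hV j), smul_smul, div_eq_inv_mul]
      obtain ⟨z, hz⟩ := hr i _ _ (div_ne_zero hd hc) (fun j hj => by
        simpa [hj] using mul_mem (unitary_inv (hV j)) (hU j)) hS
      simp only [Function.update_self] at hz
      refine ⟨z, V i * (U i)⁻¹, mul_mem (hV i) (unitary_inv (hU i)), ?_⟩
      have hVi := (Matrix.isUnit_iff_isUnit_det _).1 (isUnit_of_mem_unitaryGroup (hV i))
      have hUi := (Matrix.isUnit_iff_isUnit_det _).1 (isUnit_of_mem_unitaryGroup (hU i))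
      have := congrArg (fun M => V i * M * ((U i)⁻¹ * A k)) hz
      simp only [Matrix.mul_assoc, Matrix.mul_nonsing_inv_cancel_left _ _ hVi,
        Matrix.mul_nonsing_inv_cancel_left _ _ hUi,
        Matrix.nonsing_inv_mul _ hAk', Matrix.mul_one] at this
      rw [this]
      simp [Matrix.mul_assoc]
    obtain ⟨W, hW, t, ht, htW⟩ := hA.exists_unitary hall
    have hV : ∀ j, Function.update (fun j => (U j)⁻¹) i ((U i)⁻¹ * W) j ∈
        Matrix.unitaryGroup ι ℂ := by
      intro j
      by_cases hj : j = i
      · subst hj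
        rw [Function.update_self]
        exact mul_mem (unitary_inv (hU j)) hW
      · rw [Function.update_of_ne hj]
        exact unitary_inv (hU j)
    refine luEquivalent_of_localOp (i := i) (A := (U i)⁻¹ * A k) hV ht hc ?_ ?_
    · rw [htW, Function.update_self, Matrix.mul_smul]
    · have e3 : Function.update (Function.update (fun j => (U j)⁻¹) i ((U i)⁻¹ * W)) i
          ((U i)⁻¹ * A k) =
            fun j => (U j)⁻¹ * Function.update (fun _ => (1 : Matrix ι ι ℂ)) i (A k) j := by
        ext1 j
        by_cases hj : j = i
        · subst hj; simp
        · simp [hj]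
      have e4 : localOp (Function.update (fun _ => 1) i (A k)) Ψ = c • localOp U Φ := hE
      rw [e3, ← localOp_localOp (fun j => (U j)⁻¹), e4, localOp_smul,
        localOp_inv fun j => isUnit_of_mem_unitaryGroup (hU j)]

lemma QuasiUnitarilyRigid.luEquivalent_of_oneRoundLOCC [Nonempty ι] {Φ Ψ : QState n ι}
    (hr : QuasiUnitarilyRigid Ψ) (hΨ : FullyEntangled Ψ) (hΦ : FullyEntangled Φ)
    (h : OneRoundLOCC Ψ Φ) : LUEquivalent Ψ Φ := by
  obtain ⟨i, m, A, U, c, hA, hU, h⟩ := h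
  have hc0 : ∀ l, c l = 0 → A l = 0 := by
    intro l hl
    refine hΨ.localOp_cancel (i := i) (U := U l)
      (fun j _ => isUnit_of_mem_unitaryGroup (hU l j)) ?_
    rw [h l, hl, zero_smul, localOp_update_zero]
  obtain ⟨k, hk⟩ := hA.exists_ne_zero
  have hc : c k ≠ 0 := fun h' => hk (hc0 k h')
  have hFE : FullyEntangled (localOp (Function.update (U k) i (A k)) Ψ) := by
    rw [h k]
    rw [fullyEntangled_iff] at hΦ ⊢
    intro i v hv
    refine hΦ i v fun x => ?_
    have := hv x
    simp only [Pi.smul_apply, smul_eq_mul, mul_left_comm _ (c k)] at this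
    rw [← Finset.mul_sum] at this
    exact (mul_eq_zero.1 this).resolve_left hc
  have hunit := hFE.of_localOp.1
  have hAk : IsUnit (A k) := by simpa using hunit i
  have hAk' := (Matrix.isUnit_iff_isUnit_det _).1 hAk
  have hall : ∀ l, ∃ z : ℂ, ∃ V ∈ Matrix.unitaryGroup ι ℂ, A l = z • (V * A k) := by
    intro l
    by_cases hl : c l = 0
    · exact ⟨0, 1, one_mem _, by rw [zero_smul, hc0 l hl]⟩
    have hS : localOp (fun j => (Function.update (U k) i (A k) j)⁻¹ *
        Function.update (U l) i (A l) j) Ψ = (c l / c k) • Ψ := by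
      have e1 : Φ = (c k)⁻¹ • localOp (Function.update (U k) i (A k)) Ψ := by
        rw [h k, smul_smul, inv_mul_cancel₀ hc, one_smul]
      rw [← localOp_localOp, h l, e1, localOp_smul, localOp_smul, localOp_inv hunit, smul_smul,
        div_eq_mul_inv]
    obtain ⟨z, hz⟩ := hr i _ _ (div_ne_zero hl hc) (fun j hj => by
      simpa [hj] using mul_mem (unitary_inv (hU k j)) (hU l j)) hS
    simp only [Function.update_self] at hz
    refine ⟨z, 1, one_mem _, ?_⟩
    have := congrArg (fun M => A k * M) hz
    simpa only [Matrix.mul_nonsing_inv_cancel_left _ _ hAk', Matrix.mul_smul, Matrix.mul_one,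
      Matrix.one_mul] using this
  obtain ⟨W, hW, t, ht, htW⟩ := hA.exists_unitary hall
  refine luEquivalent_of_localOp (U := Function.update (U k) i W) (i := i) (A := A k)
    (fun j => ?_) ht hc (by simpa using htW) (by simpa using h k)
  by_cases hj : j = i
  · subst hj; simpa using hW
  · simpa [hj] using hU k j

/-- Fully entangled states without quasi-unitary symmetries are weakly isolated. -/
theorem QuasiUnitarilyRigid.weaklyIsolated [NeZero n] [Nonempty ι] {Φ : QState n ι}
    (hr : QuasiUnitarilyRigid Φ) (hΦ : FullyEntangled Φ) : WeaklyIsolated Φ := by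
  constructor
  · rintro ⟨Ψ, hΨ, hne, h⟩
    refine hne (hr.luEquivalent_of_finiteRoundLOCC hΦ h ?_)
    rintro rfl
    have := (fullyEntangled_iff (0 : QState n ι)).1 hΨ 0 1 (by simp)
    exact one_ne_zero this
  · rintro ⟨Φ', hΦ', hne, h⟩
    exact hne (hr.luEquivalent_of_oneRoundLOCC hΦ hΦ' h)

end WeakIsolation

section Qubits

open scoped MatrixOrder in
lemma exists_isUnit_conjTranspose_mul_self {ι : Type} [Fintype ι] [DecidableEq ι]
    {H : Matrix ι ι ℂ} (hH : H.PosDef) : ∃ G : Matrix ι ι ℂ, IsUnit G ∧ H = Gᴴ * G := by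
  obtain ⟨X, hX, -, hXH⟩ :=
    CFC.exists_sqrt_of_isSelfAdjoint_of_quasispectrumRestricts hH.isHermitian
      (QuasispectrumRestricts.nnreal_of_nonneg hH.posSemidef.nonneg)
  have hX' : Xᴴ = X := hX
  refine ⟨X, ?_, by rw [hX', hXH]⟩
  have := hH.isUnit
  rw [← hXH, Matrix.isUnit_iff_isUnit_det, Matrix.det_mul] at this
  rw [Matrix.isUnit_iff_isUnit_det]
  exact isUnit_of_mul_isUnit_left this

variable {n : ℕ}

lemma FiniteRoundLOCC.of_localOp {ι : Type} [Fintype ι] [DecidableEq ι] {Φ Ψ : QState n ι}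
    {U : Fin n → Matrix ι ι ℂ} (hU : ∀ j, U j ∈ Matrix.unitaryGroup ι ℂ)
    (h : FiniteRoundLOCC Φ (localOp U Ψ)) : FiniteRoundLOCC Φ Ψ := by
  classical
  suffices H : ∀ s : Finset (Fin n),
      FiniteRoundLOCC Φ (localOp (fun j => if j ∈ s then U j else 1) Ψ) →
        FiniteRoundLOCC Φ Ψ from H Finset.univ (by simpa using h)
  intro s
  induction s using Finset.induction_on with
  | empty => simp
  | insert a s ha ih =>
    intro h
    refine ih (FiniteRoundLOCC.round a 1 (fun _ => U a) ?_ fun _ _ => ?_)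
    · rw [IsMeasurement, Fin.sum_univ_one]
      exact Matrix.mem_unitaryGroup_iff'.1 (hU a)
    · rw [actAt, localOp_localOp]
      convert h using 2
      ext1 j
      by_cases hj : j = a
      · subst hj; simp [ha]
      · simp [hj]

lemma LUEquivalent.gram_det_trace {Ψ Φ : QState n (Fin 2)} (h : LUEquivalent Ψ Φ) (i : Fin n) :
    ∃ r : ℂ, (gram Ψ i).det = r ^ 2 * (gram Φ i).det ∧
      (gram Ψ i).trace = r * (gram Φ i).trace := by
  obtain ⟨U, c, hU, hc, rfl⟩ := h
  refine ⟨c * star c, ?_, ?_⟩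
  · rw [gram_smul, gram_localOp (fun j _ => hU j), Matrix.det_smul, Fintype.card_fin,
      Matrix.det_mul, Matrix.det_mul, mul_right_comm, ← Matrix.det_mul,
      ← Matrix.star_eq_conjTranspose, Matrix.mem_unitaryGroup_iff.1 (hU i), Matrix.det_one, one_mul]
  · rw [gram_smul, gram_localOp (fun j _ => hU j), Matrix.trace_smul, smul_eq_mul,
      Matrix.trace_mul_cycle, ← Matrix.star_eq_conjTranspose, Matrix.mem_unitaryGroup_iff'.1 (hU i),
      Matrix.one_mul]

lemma trace_det_of_mul_self_eq_one {T : Matrix (Fin 2) (Fin 2) ℂ} (hT : T * T = 1)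
    (hns : ∀ w : ℂ, T ≠ w • 1) : T 1 1 = - T 0 0 ∧ T 0 0 * T 0 0 + T 0 1 * T 1 0 = 1 := by
  have h00 := congrFun (congrFun hT 0) 0
  have h01 := congrFun (congrFun hT 0) 1
  have h10 := congrFun (congrFun hT 1) 0
  have h11 := congrFun (congrFun hT 1) 1
  simp [Matrix.mul_apply, Fin.sum_univ_two] at h00 h01 h10 h11
  refine ⟨?_, h00⟩
  by_contra hne
  have hs : T 0 0 + T 1 1 ≠ 0 := fun h => hne (eq_neg_of_add_eq_zero_right h)
  have hb : T 0 1 = 0 := by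
    have : T 0 1 * (T 0 0 + T 1 1) = 0 := by linear_combination h01
    exact (mul_eq_zero.1 this).resolve_right hs
  have hc : T 1 0 = 0 := by
    have : T 1 0 * (T 0 0 + T 1 1) = 0 := by linear_combination h10
    exact (mul_eq_zero.1 this).resolve_right hs
  have hd : T 0 0 = T 1 1 := by
    have : (T 0 0 - T 1 1) * (T 0 0 + T 1 1) = 0 := by
      linear_combination h00 - h11
    exact sub_eq_zero.1 ((mul_eq_zero.1 this).resolve_right hs)
  refine hns (T 0 0) ?_
  ext a b
  fin_cases a <;> fin_cases b <;> simp [hb, hc, hd]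

/-- A Hermitian traceless involution anticommutes with another one. -/
lemma exists_anticommuting {T : Matrix (Fin 2) (Fin 2) ℂ} (hH : Tᴴ = T) (htr : T 1 1 = - T 0 0) :
    ∃ w : ℂ, w * star w = 1 ∧ T * !![0, w; star w, 0] = -(!![0, w; star w, 0] * T) := by
  have h10 : T 1 0 = star (T 0 1) := by
    have := congrFun (congrFun hH 1) 0
    simpa using this.symm
  obtain ⟨w, hw, hq⟩ : ∃ w : ℂ, w * star w = 1 ∧ T 0 1 * star w + w * star (T 0 1) = 0 := by
    by_cases hq : T 0 1 = 0
    · exact ⟨1, by simp, by simp [hq]⟩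
    · have hn : (‖T 0 1‖ : ℂ) ≠ 0 := by simpa using hq
      have hm : T 0 1 * star (T 0 1) = (‖T 0 1‖ : ℂ) ^ 2 := Complex.mul_conj' _
      have hI : Complex.I * Complex.I = -1 := Complex.I_mul_I
      refine ⟨Complex.I * T 0 1 / ‖T 0 1‖, ?_, ?_⟩
      · simp only [star_div₀, star_mul', Complex.star_def, Complex.conj_I, Complex.conj_ofReal]
          at hm ⊢
        field_simp
        linear_combination (-Complex.I * Complex.I) * hm - (‖T 0 1‖ : ℂ) ^ 2 * hI
      · simp only [star_div₀, star_mul', Complex.star_def, Complex.conj_I, Complex.conj_ofReal]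
        field_simp
        ring
  refine ⟨w, hw, ?_⟩
  simp only [Complex.star_def] at hq h10
  ext a b
  simp only [Matrix.neg_apply, Matrix.mul_apply, Fin.sum_univ_two]
  fin_cases a <;> fin_cases b <;> simp [h10, htr] <;>
    first | ring1 | linear_combination hq

variable {Φ : QState n (Fin 2)} {i : Fin n} {S : Fin n → Matrix (Fin 2) (Fin 2) ℂ} {c : ℂ}

lemma convertible_of_involution (hΦ : FullyEntangled Φ)
    (hS : ∀ j, j ≠ i → S j ∈ Matrix.unitaryGroup (Fin 2) ℂ)
    (hsym : localOp S Φ = c • Φ) (hP : S i * gram Φ i * (S i)ᴴ = gram Φ i)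
    (hT : S i * S i = 1) (hH : (S i)ᴴ = S i) (htr : S i 1 1 = - S i 0 0) : Convertible Φ := by
  obtain ⟨w, hw, hanti⟩ := exists_anticommuting hH htr
  set Y : Matrix (Fin 2) (Fin 2) ℂ := !![0, w; star w, 0] with hY
  have hYH : Yᴴ = Y := by
    ext a b
    fin_cases a <;> fin_cases b <;> simp [hY]
  have hYY : Y * Y = 1 := by
    ext a b
    fin_cases a <;> fin_cases b <;> simp [hY, Matrix.mul_apply, Fin.sum_univ_two] <;>
      simp at hw <;> linear_combination hw
  set A : Matrix (Fin 2) (Fin 2) ℂ := (7 / 10 : ℂ) • 1 + (1 / 10 : ℂ) • Y with hA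
  have hAH : Aᴴ = A := by
    rw [hA, Matrix.conjTranspose_add, Matrix.conjTranspose_smul, Matrix.conjTranspose_smul, hYH]
    simp
  have hAA : A * A = (1 / 2 : ℂ) • 1 + (14 / 100 : ℂ) • Y := by
    rw [hA]
    simp only [Matrix.add_mul, Matrix.mul_add, Matrix.smul_mul, Matrix.mul_smul, Matrix.one_mul,
      Matrix.mul_one, hYY]
    module
  have hdet : A.det = 12 / 25 := by
    have : star w * w = 1 := by rw [mul_comm]; exact hw
    simp [hA, hY, Matrix.det_fin_two]
    simp at this
    linear_combination (-1 / 100) * this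
  have hAu : IsUnit A := by
    rw [Matrix.isUnit_iff_isUnit_det, hdet]
    norm_num
  have hSAAS : S i * (A * A) * S i = (1 / 2 : ℂ) • 1 - (14 / 100 : ℂ) • Y := by
    rw [hAA]
    simp only [Matrix.add_mul, Matrix.mul_add, Matrix.smul_mul, Matrix.mul_smul, Matrix.mul_one,
      hT, hanti, Matrix.neg_mul, Matrix.mul_assoc]
    module
  refine ⟨actAt i A Φ, hΦ.localOp fun j => ?_, fun hLU => ?_, i, 2, ![A, A * S i],
    ![fun _ => 1, Function.update S i 1], ![1, c], ?_, ?_, ?_⟩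
  · by_cases hj : j = i
    · subst hj; simpa using hAu
    · simp [hj]
  · have hgr : gram (actAt i A Φ) i = A * gram Φ i * A := by
      rw [actAt, gram_localOp]
      · simp [hAH]
      · intro j hj
        simp [hj, one_mem]
    obtain ⟨r, hr1, hr2⟩ := hLU.gram_det_trace i
    have hpd := gram_posDef hΦ i
    have htY : (Y * gram Φ i).trace = 0 := by
      have h1 : (Y * gram Φ i).trace = -(Y * gram Φ i).trace := by
        calc (Y * gram Φ i).trace = (Y * (S i * gram Φ i * S i)).trace := by
              rw [hH] at hP
              rw [hP]
          _ = (S i * Y * S i * gram Φ i).trace := by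
            rw [← Matrix.mul_assoc, Matrix.trace_mul_comm, ← Matrix.mul_assoc, ← Matrix.mul_assoc]
          _ = -(Y * gram Φ i).trace := by
            rw [hanti, Matrix.neg_mul, Matrix.mul_assoc Y, hT, Matrix.mul_one, Matrix.neg_mul,
              Matrix.trace_neg]
      linear_combination (1 / 2 : ℂ) * h1
    have htr2 : (A * gram Φ i * A).trace = (1 / 2) * (gram Φ i).trace := by
      rw [Matrix.trace_mul_comm, ← Matrix.mul_assoc, hAA, Matrix.add_mul, Matrix.smul_mul,
        Matrix.smul_mul, Matrix.trace_add, Matrix.trace_smul, Matrix.trace_smul, htY,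
        Matrix.one_mul]
      simp
    rw [hgr, Matrix.det_mul, Matrix.det_mul, hdet] at hr1
    rw [hgr, htr2] at hr2
    have hr : r = 2 := by
      have : (gram Φ i).trace * (r - 2) = 0 := by linear_combination (-2) * hr2
      have := (mul_eq_zero.1 this).resolve_left hpd.trace_pos.ne'
      linear_combination this
    subst hr
    have : (gram Φ i).det = 0 := by linear_combination (1 / (1 - 4 * 144 / 625)) * hr1
    exact hpd.det_pos.ne' this
  · rw [IsMeasurement, Fin.sum_univ_two]
    simp only [Matrix.cons_val_zero, Matrix.cons_val_one, Matrix.conjTranspose_mul, hAH, hH]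
    rw [Matrix.mul_assoc, ← Matrix.mul_assoc A A, ← Matrix.mul_assoc, hSAAS, hAA]
    module
  · intro k j
    fin_cases k
    · simp [one_mem]
    · by_cases hj : j = i
      · subst hj; simp [one_mem]
      · simpa [hj] using hS j hj
  · intro k
    fin_cases k
    · simp [actAt]
    · simp only [Fin.mk_one, Matrix.cons_val_one, Matrix.cons_val_fin_one, Function.update_idem]
      rw [actAt, ← localOp_smul, ← hsym, localOp_localOp]
      congr 1
      ext1 j
      by_cases hj : j = i
      · subst hj; simp
      · simp [hj]

lemma reachable_of_involution (hΦ : FullyEntangled Φ) (hc : c ≠ 0)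
    (hS : ∀ j, j ≠ i → S j ∈ Matrix.unitaryGroup (Fin 2) ℂ)
    (hsym : localOp S Φ = c • Φ) (hP : S i * gram Φ i * (S i)ᴴ = gram Φ i)
    (hT : S i * S i = 1) (hH : (S i)ᴴ ≠ S i) (htr : S i 1 1 = - S i 0 0)
    (hdt : S i 0 0 * S i 0 0 + S i 0 1 * S i 1 0 = 1) : Reachable Φ := by
  have hpd1 : (1 + (S i)ᴴ * S i).PosDef :=
    Matrix.PosDef.one.add_posSemidef (Matrix.posSemidef_conjTranspose_mul_self _)
  obtain ⟨G, hG, hGG⟩ := exists_isUnit_conjTranspose_mul_self hpd1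
  have hG' := (Matrix.isUnit_iff_isUnit_det _).1 hG
  have hGi : ∀ M : Matrix (Fin 2) (Fin 2) ℂ, actAt i (M * G⁻¹) (actAt i G Φ) = actAt i M Φ := by
    intro M
    rw [actAt, actAt, localOp_localOp, actAt]
    congr 1
    ext1 j
    by_cases hj : j = i
    · subst hj; simp [Matrix.mul_assoc, Matrix.nonsing_inv_mul _ hG']
    · simp [hj]
  refine ⟨actAt i G Φ, hΦ.localOp fun j => ?_, fun hLU => hH ?_,
    FiniteRoundLOCC.round i 2 ![1 * G⁻¹, S i * G⁻¹] ?_ fun k _ => ?_⟩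
  · by_cases hj : j = i
    · subst hj; simpa using hG
    · simp [hj]
  · have hgr : gram (actAt i G Φ) i = G * gram Φ i * Gᴴ := by
      rw [actAt, gram_localOp]
      · simp
      · intro j hj
        simp [hj, one_mem]
    obtain ⟨r, hr1, hr2⟩ := hLU.gram_det_trace i
    have hpd := gram_posDef hΦ i
    have htr2 : (G * gram Φ i * Gᴴ).trace = 2 * (gram Φ i).trace := by
      rw [Matrix.trace_mul_cycle, ← hGG, Matrix.add_mul, Matrix.trace_add, Matrix.one_mul,
        ← Matrix.trace_mul_cycle, hP]
      ring
    have hdet2 : (G * gram Φ i * Gᴴ).det = (1 + (S i)ᴴ * S i).det * (gram Φ i).det := by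
      rw [hGG]
      simp only [Matrix.det_mul]
      ring
    rw [hgr, hdet2] at hr1
    rw [hgr, htr2] at hr2
    have hr : r = 2 := by
      have : (gram Φ i).trace * (r - 2) = 0 := by linear_combination -hr2
      have := (mul_eq_zero.1 this).resolve_left hpd.trace_pos.ne'
      linear_combination this
    subst hr
    have h4 : (1 + (S i)ᴴ * S i).det = 4 := by
      refine mul_right_cancel₀ hpd.det_pos.ne' ?_
      linear_combination hr1
    have h10 : star (S i 0 0) * star (S i 0 0) + star (S i 0 1) * star (S i 1 0) = 1 := by
      rw [← star_mul', ← star_mul', ← star_add, hdt, star_one]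
    have hzero : ((S i - (S i)ᴴ)ᴴ * (S i - (S i)ᴴ)).trace = 0 := by
      simp only [Matrix.trace_fin_two, Matrix.mul_apply, Fin.sum_univ_two, Matrix.det_fin_two,
        Matrix.conjTranspose_apply, Matrix.sub_apply, Matrix.add_apply, star_sub, star_star,
        Matrix.one_apply, htr, star_neg] at h4 ⊢
      simp at h4 h10 hdt ⊢
      set p := S i 0 0
      set q := S i 0 1
      set s := S i 1 0
      set p' := (starRingEnd ℂ) p
      set q' := (starRingEnd ℂ) q
      set s' := (starRingEnd ℂ) s
      linear_combination 2 * h4 - 2 * hdt - 2 * h10 - 2 * (hdt * (p' * p' + q' * s') + h10)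
    rw [Matrix.trace_conjTranspose_mul_self_eq_zero_iff, sub_eq_zero] at hzero
    exact hzero.symm
  · have hGG1 : (G⁻¹)ᴴ * (Gᴴ * G) * G⁻¹ = 1 := by
      rw [Matrix.mul_assoc, Matrix.mul_assoc, Matrix.mul_nonsing_inv _ hG', Matrix.mul_one,
        ← Matrix.conjTranspose_mul, Matrix.mul_nonsing_inv _ hG', Matrix.conjTranspose_one]
    rw [IsMeasurement, Fin.sum_univ_two]
    refine Eq.trans ?_ hGG1
    rw [← hGG]
    simp only [Matrix.cons_val_zero, Matrix.cons_val_one, Matrix.conjTranspose_mul, Matrix.one_mul,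
      Matrix.mul_add, Matrix.add_mul, Matrix.mul_one, Matrix.mul_assoc]
  · fin_cases k
    · simp only [Fin.zero_eta, Matrix.cons_val_zero]
      rw [hGi]
      exact FiniteRoundLOCC.done 1 one_ne_zero (by simp [actAt])
    · simp only [Fin.mk_one, Matrix.cons_val_one, Matrix.cons_val_fin_one]
      rw [hGi]
      refine FiniteRoundLOCC.of_localOp (U := Function.update S i 1) (fun j => ?_)
        (FiniteRoundLOCC.done c hc ?_)
      · by_cases hj : j = i
        · subst hj; simp [one_mem]
        · simpa [hj] using hS j hj
      · rw [actAt, localOp_localOp, ← hsym]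
        congr 1
        ext1 j
        by_cases hj : j = i
        · subst hj; simp
        · simp [hj]

/-- A qubit state with a non-trivial local symmetry of order two that is unitary at all parties
but one is not weakly isolated. -/
theorem not_weaklyIsolated_of_symmetry (hΦ : FullyEntangled Φ) (hc : c ≠ 0)
    (hS : ∀ j, j ≠ i → S j ∈ Matrix.unitaryGroup (Fin 2) ℂ) (hsym : localOp S Φ = c • Φ)
    {z : ℂ} (hz : S i * S i = z • 1) (hns : ∀ w : ℂ, S i ≠ w • 1) : ¬ WeaklyIsolated Φ := by
  have hpd := gram_posDef hΦ i
  have hunit : IsUnit (S i) := by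
    have : FullyEntangled (localOp S Φ) := by
      rw [hsym, ← localOp_one Φ]
      have e : c • localOp (fun _ => 1) Φ =
          localOp (Function.update (fun _ => 1) i (c • (1 : Matrix (Fin 2) (Fin 2) ℂ))) Φ := by
        rw [localOp_update_smul, Function.update_eq_self_iff.2 rfl]
      rw [e]
      refine hΦ.localOp fun j => ?_
      by_cases hj : j = i
      · subst hj
        rw [Function.update_self, Matrix.isUnit_iff_isUnit_det]
        simp [hc]
      · simp [hj]
    exact this.of_localOp.1 i
  have hz0 : z ≠ 0 := by
    rintro rfl
    have := hunit.mul hunit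
    rw [hz, zero_smul] at this
    exact not_isUnit_zero this
  obtain ⟨τ, hτ⟩ : ∃ τ : ℂ, τ ^ 2 = z := IsAlgClosed.exists_pow_nat_eq z two_pos
  have hτ0 : τ ≠ 0 := by
    rintro rfl
    exact hz0 (by simpa using hτ.symm)
  set R := Function.update S i (τ⁻¹ • S i) with hR
  have hRi : R i = τ⁻¹ • S i := by simp [hR]
  have hRj : ∀ j, j ≠ i → R j ∈ Matrix.unitaryGroup (Fin 2) ℂ := fun j hj => by
    simpa [hR, hj] using hS j hj
  have hRsym : localOp R Φ = (τ⁻¹ * c) • Φ := by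
    rw [hR, localOp_update_smul, Function.update_eq_self, hsym, smul_smul]
  have hc' : τ⁻¹ * c ≠ 0 := mul_ne_zero (inv_ne_zero hτ0) hc
  have hRR : R i * R i = 1 := by
    rw [hRi, Matrix.smul_mul, Matrix.mul_smul, hz, smul_smul, smul_smul, ← hτ]
    rw [show τ⁻¹ * τ⁻¹ * τ ^ 2 = 1 by field_simp, one_smul]
  have hRns : ∀ w : ℂ, R i ≠ w • 1 := by
    intro w hw
    refine hns (τ * w) ?_
    rw [mul_smul, ← hw, hRi, smul_smul, mul_inv_cancel₀ hτ0, one_smul]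
  obtain ⟨htr, hdt⟩ := trace_det_of_mul_self_eq_one hRR hRns
  have hgr : R i * gram Φ i * (R i)ᴴ = (τ⁻¹ * c * star (τ⁻¹ * c)) • gram Φ i := by
    rw [← gram_localOp hRj, hRsym, gram_smul]
  have hone : τ⁻¹ * c * star (τ⁻¹ * c) = 1 := by
    have hdR : (R i).det = -1 := by
      rw [Matrix.det_fin_two, htr]
      linear_combination -hdt
    have h1 := congrArg Matrix.det hgr
    rw [Matrix.det_mul, Matrix.det_mul, Matrix.det_conjTranspose, hdR, Matrix.det_smul,
      Fintype.card_fin] at h1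
    set d := τ⁻¹ * c
    have h2 : (d * star d) ^ 2 = 1 := by
      refine mul_right_cancel₀ hpd.det_pos.ne' ?_
      rw [← h1]
      simp
    have h3 : d * star d = ((‖d‖ ^ 2 : ℝ) : ℂ) := by
      push_cast
      exact Complex.mul_conj' d
    rw [h3] at h2 ⊢
    have h4 : (‖d‖ ^ 2 : ℝ) ^ 2 = 1 := by exact_mod_cast h2
    rw [(pow_eq_one_iff_of_nonneg (by positivity) two_ne_zero).1 h4]
    simp
  rw [hone, one_smul] at hgr
  rintro ⟨h1, h2⟩
  by_cases hH : (R i)ᴴ = R i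
  · exact h2 (convertible_of_involution hΦ hRj hRsym hgr hRR hH htr)
  · exact h1 (reachable_of_involution hΦ hc' hRj hRsym hgr hRR hH htr hdt)

end Qubits

section FormStates

variable {n : ℕ} {A : Type} [CommRing A] [Algebra ℂ A] {ι κ : Type} [Fintype ι] [DecidableEq ι]
  [Fintype κ] [DecidableEq κ]

/-- The state with amplitudes `φ (f 0 x₀ * ⋯ * f (n-1) xₙ₋₁)`, where `φ` is a linear form on a
commutative algebra. -/
def formState (φ : A →ₗ[ℂ] ℂ) (f : Fin n → ι → A) : QState n ι :=
  fun x => φ (∏ i, f i (x i))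

lemma localOp_formState (φ : A →ₗ[ℂ] ℂ) (f : Fin n → ι → A) (S : Fin n → Matrix κ ι ℂ) :
    localOp S (formState φ f) = formState φ fun i y => ∑ x, S i y x • f i x := by
  ext y
  simp only [localOp, formState]
  rw [Finset.prod_univ_sum, Fintype.piFinset_univ, map_sum]
  refine Finset.sum_congr rfl fun x _ => ?_
  rw [Finset.prod_smul, map_smul, smul_eq_mul]

lemma map_prod_of_basis (φ : A →ₗ[ℂ] ℂ) (f : Fin n → Module.Basis ι ℂ A)
    (s : Fin n → A →ₗ[ℂ] A) (c : ℂ)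
    (h : ∀ x : Fin n → ι, φ (∏ i, s i (f i (x i))) = c * φ (∏ i, f i (x i))) (a : Fin n → A) :
    φ (∏ i, s i (a i)) = c * φ (∏ i, a i) := by
  have : φ.compMultilinearMap ((MultilinearMap.mkPiAlgebra ℂ (Fin n) A).compLinearMap s) =
      c • φ.compMultilinearMap (MultilinearMap.mkPiAlgebra ℂ (Fin n) A) := by
    refine Module.Basis.ext_multilinear f fun x => ?_
    simpa using h x
  simpa using congrArg (fun M => M a) this

lemma prod_update_three {M : Type} [CommMonoid M] {B : Type} (F : Fin n → B → M) (g : Fin n → B)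
    {i j m : Fin n} (hij : i ≠ j) (him : i ≠ m) (hjm : j ≠ m) (a b d : B) :
    ∏ o, F o (Function.update (Function.update (Function.update g i a) j b) m d o) =
      F i a * F j b * F m d * ∏ o ∈ ((Finset.univ.erase i).erase j).erase m, F o (g o) := by
  rw [← Finset.mul_prod_erase _ _ (Finset.mem_univ i),
    ← Finset.mul_prod_erase (Finset.univ.erase i) _ (a := j) (by simp [hij.symm]),
    ← Finset.mul_prod_erase ((Finset.univ.erase i).erase j) _ (a := m)
      (by simp [hjm.symm, him.symm])]
  rw [Finset.prod_congr rfl (g := fun o => F o (g o)) fun o ho => ?_]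
  · simp only [Function.update_self, Function.update_of_ne hij, Function.update_of_ne him,
      Function.update_of_ne hjm, mul_assoc]
  · simp only [Finset.mem_erase, Finset.mem_univ, and_true] at ho
    rw [Function.update_of_ne ho.1, Function.update_of_ne ho.2.1, Function.update_of_ne ho.2.2]

lemma exists_third (hn : 3 ≤ n) (i j : Fin n) : ∃ m, i ≠ m ∧ j ≠ m := by
  have : ({i, j} : Finset (Fin n)).card < Fintype.card (Fin n) := by
    rw [Fintype.card_fin]
    exact lt_of_le_of_lt Finset.card_le_two hn
  obtain ⟨m, hm⟩ := Finset.exists_mem_notMem_of_card_lt_card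
    (t := Finset.univ) (s := {i, j}) (by simpa using this)
  simp only [Finset.mem_insert, Finset.mem_singleton, not_or] at hm
  exact ⟨m, fun h => hm.2.1 h.symm, fun h => hm.2.2 h.symm⟩

/-- Local symmetries of `φ (a₁ ⋯ aₙ)` for a nondegenerate linear form `φ` on a commutative
algebra are multiplications by units composed with a common algebra endomorphism. -/
theorem exists_algHom_of_symmetry [FiniteDimensional ℂ A] (hn : 3 ≤ n) {φ : A →ₗ[ℂ] ℂ}
    (hφ : ∀ a, (∀ b, φ (a * b) = 0) → a = 0) {s : Fin n → A →ₗ[ℂ] A} {c : ℂ} (hc : c ≠ 0)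
    (h : ∀ a : Fin n → A, φ (∏ i, s i (a i)) = c * φ (∏ i, a i)) :
    ∃ (σ : A →ₐ[ℂ] A) (u : Fin n → Aˣ), Function.Injective σ ∧ ∀ i a, s i a = u i * σ a := by
  have hinj : ∀ i, Function.Injective (s i) := by
    intro i
    rw [← LinearMap.ker_eq_bot, LinearMap.ker_eq_bot']
    intro a ha
    refine hφ a fun b => ?_
    obtain ⟨j, hij, -⟩ := exists_third hn i i
    obtain ⟨m, him, hjm⟩ := exists_third hn i j
    have h1 := h (Function.update (Function.update (Function.update 1 i a) j b) m 1)
    rw [prod_update_three (fun o => s o) 1 hij him hjm,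
      prod_update_three (fun _ z => z) 1 hij him hjm, ha] at h1
    simpa [hc] using h1
  have hsurj : ∀ i, Function.Surjective (s i) := fun i =>
    LinearMap.surjective_of_injective (hinj i)
  choose g hg using fun i => hsurj i 1
  have key : ∀ i j, i ≠ j → ∀ a b, s i a * s j b = s i (a * b) * s j 1 := by
    intro i j hij a b
    obtain ⟨m, him, hjm⟩ := exists_third hn i j
    rw [← sub_eq_zero]
    refine hφ _ fun d => ?_
    obtain ⟨d, rfl⟩ := hsurj m d
    have h1 := h (Function.update (Function.update (Function.update g i a) j b) m d)
    have h2 := h (Function.update (Function.update (Function.update g i (a * b)) j 1) m d)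
    rw [prod_update_three (fun o => s o) g hij him hjm,
      prod_update_three (fun _ z => z) g hij him hjm] at h1 h2
    simp only [hg, Finset.prod_const_one, mul_one] at h1 h2
    rw [sub_mul, map_sub, h1, h2, sub_self]
  have hunit : ∀ j, IsUnit (s j 1) := by
    intro j
    obtain ⟨i, hij, -⟩ := exists_third hn j j
    have := key i j hij.symm (g i) (g j)
    rw [hg, hg, one_mul, mul_comm] at this
    exact IsUnit.of_mul_eq_one _ this.symm
  choose u hu using hunit
  have hcomm : ∀ i j a, s i a * u j = u i * s j a := by
    intro i j a
    by_cases hij : i = j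
    · subst hij; rw [mul_comm]
    · have := key i j hij 1 a
      rw [one_mul] at this
      rw [hu, hu, this]
  have h0 : 0 < n := by omega
  set i₀ : Fin n := ⟨0, h0⟩
  obtain ⟨j₀, hij, -⟩ := exists_third hn i₀ i₀
  let σl : A →ₗ[ℂ] A := (LinearMap.mulLeft ℂ (((u i₀)⁻¹ : Aˣ) : A)).comp (s i₀)
  have hσl : ∀ i a, s i a = u i * σl a := by
    intro i a
    have := hcomm i₀ i a
    simp only [σl, LinearMap.comp_apply, LinearMap.mulLeft_apply]
    rw [mul_left_comm, Units.eq_inv_mul_iff_mul_eq, mul_comm _ (s i₀ a), ← this]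
  refine ⟨AlgHom.ofLinearMap σl ?_ fun a b => ?_, u, fun a b hab => ?_, hσl⟩
  · have := hσl i₀ 1
    rw [← hu] at this
    exact (u i₀).isUnit.mul_left_cancel (by rw [mul_one, ← this])
  · have := key i₀ j₀ hij a b
    rw [← hu j₀, hσl, hσl, hσl] at this
    have h2 : (u i₀ * u j₀ : A) * (σl (a * b)) = (u i₀ * u j₀ : A) * (σl a * σl b) := by
      linear_combination -this
    rwa [← Units.val_mul, Units.mul_right_inj] at h2
  · apply hinj i₀
    rw [hσl, hσl]
    exact congrArg _ hab

lemma symmetry_of_localOp_eq {φ : A →ₗ[ℂ] ℂ} {f : Fin n → Module.Basis ι ℂ A}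
    {S : Fin n → Matrix ι ι ℂ} {c : ℂ}
    (h : localOp S (formState φ fun i => f i) = c • formState φ fun i => f i) (a : Fin n → A) :
    φ (∏ i, (f i).constr ℂ (fun y => ∑ x, S i y x • f i x) (a i)) = c * φ (∏ i, a i) := by
  refine map_prod_of_basis φ f _ c (fun x => ?_) a
  rw [localOp_formState] at h
  simpa [formState, Module.Basis.constr_basis] using congrFun h x

lemma fullyEntangled_formState (hn : 3 ≤ n) {φ : A →ₗ[ℂ] ℂ}
    (hφ : ∀ a, (∀ b, φ (a * b) = 0) → a = 0) (f : Fin n → Module.Basis ι ℂ A) :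
    FullyEntangled (formState φ fun i => f i) := by
  rw [fullyEntangled_iff]
  intro i v hv
  rcases isEmpty_or_nonempty ι with hι | ⟨⟨x₀⟩⟩
  · exact Subsingleton.elim _ _
  set w := ∑ a, v a • f i a with hw
  have hw0 : w = 0 := by
    refine hφ w fun b => ?_
    obtain ⟨j, hij, -⟩ := exists_third hn i i
    obtain ⟨m, him, hjm⟩ := exists_third hn i j
    have h1 := map_prod_of_basis φ f
      (Function.update (fun _ => LinearMap.id) i ((f i).constr ℂ fun _ => w)) 0 (fun x => ?_)
      (Function.update (Function.update (Function.update 1 i (f i x₀)) j b) m 1)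
    · rw [prod_update_three (fun o => Function.update (fun _ => LinearMap.id) i
        ((f i).constr ℂ fun _ => w) o) 1 hij him hjm] at h1
      simp only [Function.update_self, Function.update_of_ne hij.symm,
        Function.update_of_ne him.symm, Module.Basis.constr_basis, LinearMap.id_apply, zero_mul,
        mul_one] at h1
      rw [Finset.prod_eq_one, mul_one] at h1
      · exact h1
      · intro o ho
        simp only [Finset.mem_erase, Finset.mem_univ, and_true] at ho
        simp [ho.2.2]
    · rw [zero_mul, ← hv x]
      simp only [formState]
      have key : ∀ a, ∏ o, f o (Function.update x i a o) =
          f i a * ∏ o ∈ Finset.univ.erase i, f o (x o) := by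
        intro a
        rw [← Finset.mul_prod_erase _ _ (Finset.mem_univ i), Function.update_self]
        congr 1
        exact Finset.prod_congr rfl fun o ho => by
          rw [Function.update_of_ne (Finset.ne_of_mem_erase ho)]
      rw [← Finset.mul_prod_erase _ _ (Finset.mem_univ i), Function.update_self,
        Module.Basis.constr_basis, hw, Finset.sum_mul, map_sum]
      refine Finset.sum_congr rfl fun a _ => ?_
      rw [key, smul_mul_assoc, map_smul, smul_eq_mul]
      congr 3
      exact Finset.prod_congr rfl fun o ho => by
          rw [Function.update_of_ne (Finset.ne_of_mem_erase ho), LinearMap.id_apply]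
  ext a
  exact Fintype.linearIndependent_iff.1 (f i).linearIndependent v hw0 a

lemma sloccEquivalent_formState (φ : A →ₗ[ℂ] ℂ) (f : Fin n → Module.Basis κ ℂ A)
    (g : Fin n → Module.Basis ι ℂ A) :
    SLOCCEquivalent (formState φ fun i => f i) (formState φ fun i => g i) := by
  refine ⟨fun i => ((g i).toMatrix (f i))ᵀ, fun i => ((f i).toMatrix (g i))ᵀ, fun i => ⟨?_, ?_⟩, ?_⟩
  · rw [← Matrix.transpose_mul, Module.Basis.toMatrix_mul_toMatrix_flip, Matrix.transpose_one]
  · rw [← Matrix.transpose_mul, Module.Basis.toMatrix_mul_toMatrix_flip, Matrix.transpose_one]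
  · rw [localOp_formState]
    congr 1
    ext1 i
    ext1 y
    simp [Module.Basis.toMatrix_apply, Module.Basis.sum_repr]

lemma SLOCCEquivalent.symm {Ψ : QState n κ} {Φ : QState n ι} (h : SLOCCEquivalent Ψ Φ) :
    SLOCCEquivalent Φ Ψ := by
  obtain ⟨A, A', hA, rfl⟩ := h
  refine ⟨A', A, fun i => (hA i).symm, ?_⟩
  rw [localOp_localOp]
  simp [fun i => (hA i).2]

lemma SLOCCEquivalent.trans {τ : Type} [Fintype τ] [DecidableEq τ] {Ψ : QState n κ}
    {Φ : QState n ι} {X : QState n τ} (h : SLOCCEquivalent Ψ Φ) (h' : SLOCCEquivalent Φ X) :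
    SLOCCEquivalent Ψ X := by
  obtain ⟨A, A', hA, rfl⟩ := h
  obtain ⟨B, B', hB, rfl⟩ := h'
  refine ⟨fun i => A i * B i, fun i => B' i * A' i, fun i => ⟨?_, ?_⟩, ?_⟩
  · rw [Matrix.mul_assoc, ← Matrix.mul_assoc (B i), (hB i).1, Matrix.one_mul, (hA i).1]
  · rw [Matrix.mul_assoc, ← Matrix.mul_assoc (A' i), (hA i).2, Matrix.one_mul, (hB i).2]
  · rw [localOp_localOp]

lemma SLOCCEquivalent.card_eq [NeZero n] {Ψ : QState n κ} {Φ : QState n ι}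
    (h : SLOCCEquivalent Ψ Φ) : Fintype.card κ = Fintype.card ι := by
  obtain ⟨A, A', hA, -⟩ := h
  have h1 := Matrix.rank_mul_le_left (A 0) (A' 0)
  have h2 := Matrix.rank_mul_le_left (A' 0) (A 0)
  rw [(hA 0).1, Matrix.rank_one] at h1
  rw [(hA 0).2, Matrix.rank_one] at h2
  exact le_antisymm (h1.trans (Matrix.rank_le_card_width _))
    (h2.trans (Matrix.rank_le_card_width _))

end FormStates

section NilpotentPowerBasis

/-- A basis `1, y, …, y ^ k` of an algebra, where `y ^ (k + 1) = 0`. -/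
structure NilpotentPowerBasis (R : Type) [CommRing R] [Algebra ℂ R] (k : ℕ) where
  gen : R
  basis : Module.Basis (Fin (k + 1)) ℂ R
  basis_eq : ∀ l, basis l = gen ^ (l : ℕ)
  gen_pow : gen ^ (k + 1) = 0

namespace NilpotentPowerBasis

variable {R : Type} [CommRing R] [Algebra ℂ R] {k : ℕ}

lemma nonempty_of_pow_ne_zero (y : R) (hk : Module.finrank ℂ R = k + 1) (hy : y ^ k ≠ 0)
    (hy' : y ^ (k + 1) = 0) : ∃ P : NilpotentPowerBasis R k, P.gen = y := by
  have hli : LinearIndependent ℂ fun l : Fin (k + 1) => y ^ (l : ℕ) := by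
    rw [Fintype.linearIndependent_iff]
    intro c hc
    suffices H : ∀ m : ℕ, ∀ l : Fin (k + 1), (l : ℕ) = m → c l = 0 from fun l => H _ l rfl
    intro m
    induction m using Nat.strong_induction_on with
    | _ m ih =>
      intro l hl
      have h1 := congrArg (fun r => r * y ^ (k - m)) hc
      simp only [Finset.sum_mul, zero_mul] at h1
      rw [Finset.sum_eq_single l] at h1
      · rw [smul_mul_assoc, ← pow_add, show (l : ℕ) + (k - m) = k by omega] at h1
        exact (smul_eq_zero.1 h1).resolve_right hy
      · intro b _ hb
        rcases lt_or_gt_of_ne (fun h => hb (Fin.ext h) : (b : ℕ) ≠ l) with h | h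
        · rw [ih b (hl ▸ h) b rfl, zero_smul, zero_mul]
        · rw [smul_mul_assoc, ← pow_add, show (b : ℕ) + (k - m) = (k + 1) + (b - m - 1) by omega,
            pow_add, hy', zero_mul, smul_zero]
      · simp
  refine ⟨⟨y, basisOfLinearIndependentOfCardEqFinrank hli (by simp [hk]), fun l => by simp, hy'⟩,
    rfl⟩

variable (P : NilpotentPowerBasis R k)

lemma pow_eq_zero {m : ℕ} (h : k < m) : P.gen ^ m = 0 := by
  rw [← Nat.add_sub_cancel' (Nat.succ_le_of_lt h), pow_add, P.gen_pow, zero_mul]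

lemma repr_pow (m : ℕ) (l : Fin (k + 1)) :
    P.basis.repr (P.gen ^ m) l = if m = (l : ℕ) then 1 else 0 := by
  by_cases hm : k < m
  · rw [P.pow_eq_zero hm, if_neg (by omega)]
    simp
  · have := P.basis.repr_self (⟨m, by omega⟩ : Fin (k + 1))
    rw [P.basis_eq] at this
    simp only at this
    rw [this, Finsupp.single_apply]
    simp [Fin.ext_iff]

lemma gen_pow_ne_zero : P.gen ^ k ≠ 0 := by
  have := P.repr_pow k (Fin.last k)
  intro h
  rw [h] at this
  simp at this

lemma exists_eq (r : R) : ∃ (c : ℂ) (r' : R), r = c • 1 + P.gen * r' := by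
  refine ⟨P.basis.repr r 0, ∑ l : Fin k, P.basis.repr r l.succ • P.gen ^ (l : ℕ), ?_⟩
  conv_lhs => rw [← P.basis.sum_repr r, Fin.sum_univ_succ]
  rw [Finset.mul_sum]
  congr 1
  · rw [P.basis_eq]; simp
  · refine Finset.sum_congr rfl fun l _ => ?_
    rw [P.basis_eq, mul_smul_comm, Fin.val_succ, pow_succ']

lemma isUnit_or_dvd (r : R) : IsUnit r ∨ P.gen ∣ r := by
  obtain ⟨c, r', rfl⟩ := P.exists_eq r
  by_cases hc : c = 0
  · right; simp [hc]
  · left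
    rw [← Algebra.algebraMap_eq_smul_one]
    refine IsNilpotent.isUnit_add_left_of_commute ⟨k + 1, ?_⟩
      ((isUnit_iff_ne_zero.2 hc).map (algebraMap ℂ R)) (Commute.all _ _)
    rw [mul_pow, P.gen_pow, zero_mul]

lemma nontrivial (P : NilpotentPowerBasis R k) : Nontrivial R := P.basis.repr.toEquiv.nontrivial

lemma dvd_of_isNilpotent {r : R} (hr : IsNilpotent r) : P.gen ∣ r := by
  have := P.nontrivial
  exact (P.isUnit_or_dvd r).resolve_left fun h => hr.not_isUnit h

lemma eq_zero_or_one_of_idempotent (P : NilpotentPowerBasis R k) {r : R} (hr : r * r = r) :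
    r = 0 ∨ r = 1 := by
  rcases P.isUnit_or_dvd r with h | ⟨r', hr'⟩
  · right
    exact h.mul_left_cancel (by rw [hr, mul_one])
  · left
    have : r ^ (k + 1) = r := (IsIdempotentElem.pow_succ_eq k hr)
    rw [← this, hr', mul_pow, P.gen_pow, zero_mul]

lemma repr_pow_mul_eq_zero (l : ℕ) (r : R) (m : Fin (k + 1)) (hm : (m : ℕ) < l) :
    P.basis.repr (P.gen ^ l * r) m = 0 := by
  rw [← P.basis.sum_repr r, Finset.mul_sum, map_sum, Finsupp.finsetSum_apply]
  refine Finset.sum_eq_zero fun j _ => ?_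
  rw [P.basis_eq, mul_smul_comm, ← pow_add, map_smul, Finsupp.smul_apply, P.repr_pow,
    if_neg (by omega), smul_zero]

end NilpotentPowerBasis

open Polynomial in
lemma exists_nilpotentPowerBasis_quotient {p : ℂ[X]} (hp : Irreducible p) (k : ℕ) :
    ∃ P : NilpotentPowerBasis (ℂ[X] ⧸ Ideal.span {p ^ (k + 1)}) k,
      P.gen = Ideal.Quotient.mk _ p := by
  refine NilpotentPowerBasis.nonempty_of_pow_ne_zero _ ?_ ?_ ?_
  · rw [finrank_quotient_span_eq_natDegree, natDegree_pow,
      natDegree_eq_of_degree_eq_some (IsAlgClosed.degree_eq_one_of_irreducible ℂ hp)]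
    exact mul_one _
  · rw [← map_pow, Ne, Ideal.Quotient.eq_zero_iff_mem, Ideal.mem_span_singleton]
    rw [pow_dvd_pow_iff hp.ne_zero hp.not_isUnit]
    omega
  · rw [← map_pow, Ideal.Quotient.eq_zero_iff_mem, Ideal.mem_span_singleton]

end NilpotentPowerBasis

section Blocks

variable {n K : ℕ} {k : Fin K → ℕ} {R : Fin K → Type} [∀ b, CommRing (R b)]
  [∀ b, Algebra ℂ (R b)]

/-- The basis of a product of algebras with nilpotent power bases. -/
def blockBasis (P : ∀ b, NilpotentPowerBasis (R b) (k b)) :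
    Module.Basis (Σ b, Fin (k b + 1)) ℂ (∀ b, R b) :=
  Pi.basis fun b => (P b).basis

/-- The sum of the top coefficients of all blocks. -/
def blockForm (P : ∀ b, NilpotentPowerBasis (R b) (k b)) : (∀ b, R b) →ₗ[ℂ] ℂ :=
  ∑ b, (P b).basis.coord (Fin.last _) ∘ₗ LinearMap.proj b

variable (P : ∀ b, NilpotentPowerBasis (R b) (k b))

lemma blockBasis_apply (y : Σ b, Fin (k b + 1)) :
    blockBasis P y = Pi.single y.1 ((P y.1).gen ^ (y.2 : ℕ)) := by
  rw [blockBasis, Pi.basis_apply, NilpotentPowerBasis.basis_eq]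

lemma blockBasis_repr (a : ∀ b, R b) (y : Σ b, Fin (k b + 1)) :
    (blockBasis P).repr a y = (P y.1).basis.repr (a y.1) y.2 := by
  rw [blockBasis, Pi.basis_repr]

lemma blockForm_apply (a : ∀ b, R b) :
    blockForm P a = ∑ b, (P b).basis.repr (a b) (Fin.last _) := by
  simp [blockForm, LinearMap.sum_apply]

lemma blockForm_nondegenerate (a : ∀ b, R b) (h : ∀ b, blockForm P (a * b) = 0) : a = 0 := by
  refine (blockBasis P).repr.map_eq_zero_iff.1 (Finsupp.ext fun y => ?_)
  obtain ⟨b, l⟩ := y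
  rw [blockBasis_repr, Finsupp.zero_apply]
  have h1 := h (Pi.single b ((P b).gen ^ (k b - l)))
  rw [blockForm_apply, Finset.sum_eq_single b, Pi.mul_apply, Pi.single_eq_same] at h1
  · rw [← (P b).basis.sum_repr (a b), Finset.sum_mul, map_sum, Finsupp.finsetSum_apply,
      Finset.sum_eq_single l] at h1
    · rw [(P b).basis_eq, smul_mul_assoc, ← pow_add, map_smul, Finsupp.smul_apply,
        (P b).repr_pow, if_pos (by simp; omega), smul_eq_mul, mul_one] at h1
      exact h1
    · intro j _ hj
      rw [(P b).basis_eq, smul_mul_assoc, ← pow_add, map_smul, Finsupp.smul_apply,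
        (P b).repr_pow, if_neg, smul_zero]
      intro h2
      apply hj
      ext
      simp only [Fin.val_last] at h2
      omega
    · simp
  · intro c _ hc
    simp [Pi.single_eq_of_ne hc]
  · simp

lemma blockState_eq_formState [NeZero n] :
    blockState n k = formState (blockForm P) fun _ => blockBasis P := by
  ext x
  rw [blockState, directSum, Finset.sum_apply, formState, blockForm_apply]
  refine Finset.sum_congr rfl fun c _ => ?_
  simp only [Finset.sum_apply, Pi.smul_apply, smul_eq_mul, excitationState, Finset.prod_apply,
    Pi.single_apply]
  by_cases hx : ∀ i, (x i).1 = c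
  · obtain ⟨y, rfl⟩ : ∃ y : Fin n → Fin (k c + 1), x = fun i => ⟨c, y i⟩ := by
      have : ∀ i, ∃ l : Fin (k c + 1), x i = ⟨c, l⟩ := by
        intro i
        have := hx i
        generalize x i = z at this ⊢
        obtain ⟨b, l⟩ := z
        subst this
        exact ⟨l, rfl⟩
      choose y hy using this
      exact ⟨y, funext hy⟩
    rw [Finset.sum_eq_single y]
    · simp only [blockBasis_apply, Pi.single_eq_same, if_pos, mul_one]
      rw [Finset.prod_pow_eq_pow_sum, (P c).repr_pow, Fin.val_last]
    · intro y' _ hy'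
      have hne : (fun i => (⟨c, y i⟩ : Σ b, Fin (k b + 1))) ≠ fun i => ⟨c, y' i⟩ := by
        intro h
        apply hy'
        ext1 i
        have := congrFun h i
        simpa using this.symm
      rw [if_neg hne, mul_zero]
    · simp
  · push Not at hx
    obtain ⟨i, hi⟩ := hx
    rw [Finset.sum_eq_zero, Finset.prod_eq_zero (Finset.mem_univ i)]
    · simp
    · rw [blockBasis_apply, Pi.single_eq_of_ne (Ne.symm hi)]
    · intro y _
      have hne : x ≠ fun i => ⟨c, y i⟩ := by
        rintro rfl
        exact hi rfl
      rw [if_neg hne, mul_zero]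

/-- An injective endomorphism of a product of truncated polynomial algebras permutes the blocks
and preserves the degree filtrations. -/
lemma exists_perm_of_algHom (σ : (∀ b, R b) →ₐ[ℂ] (∀ b, R b)) (hσ : Function.Injective σ) :
    ∃ π : Equiv.Perm (Fin K), ∀ (u : ∀ b, R b) (y x : Σ b, Fin (k b + 1)),
      (blockBasis P).repr (u * σ (blockBasis P y)) x ≠ 0 →
        x.1 = π y.1 ∧ (y.2 : ℕ) ≤ x.2 := by
  have hnt : ∀ b, Nontrivial (R b) := fun b => (P b).nontrivial
  let ε : Fin K → (∀ b, R b) := fun b => Pi.single b 1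
  have hεε : ∀ b, ε b * ε b = ε b := fun b => by simp [ε, ← Pi.single_mul]
  have hε : ∀ b b', b ≠ b' → ε b * ε b' = 0 := fun b b' hb => by
    ext c
    by_cases hc : c = b
    · subst hc; simp [ε, Pi.single_eq_of_ne hb]
    · simp [ε, Pi.single_eq_of_ne hc]
  have hsum : ∑ b, ε b = 1 := by
    ext c
    simp [ε, Finset.sum_apply]
  have h01 : ∀ b c, σ (ε b) c = 0 ∨ σ (ε b) c = 1 := fun b c =>
    (P c).eq_zero_or_one_of_idempotent (by rw [← Pi.mul_apply, ← map_mul, hεε])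
  have hex : ∀ c, ∃ b, σ (ε b) c = 1 := by
    intro c
    by_contra! h
    have h1 : σ (∑ b, ε b) c = 0 := by
      rw [map_sum, Finset.sum_apply]
      exact Finset.sum_eq_zero fun b _ => (h01 b c).resolve_right (h b)
    rw [hsum, map_one, Pi.one_apply] at h1
    exact one_ne_zero h1
  choose ρ hρ using hex
  have hρ' : ∀ b c, ρ c ≠ b → σ (ε b) c = 0 := by
    intro b c hb
    have := congrFun (congrArg σ (hε (ρ c) b hb)) c
    rwa [map_mul, map_zero, Pi.mul_apply, hρ, one_mul] at this
  have hρs : Function.Surjective ρ := by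
    intro b
    by_contra! h
    have h1 : σ (ε b) = 0 := funext fun c => hρ' b c (h c)
    rw [← map_zero σ] at h1
    have h2 := congrFun (hσ h1) b
    simp [ε] at h2
  have hρb : Function.Bijective ρ := Finite.surjective_iff_bijective.1 hρs
  refine ⟨(Equiv.ofBijective ρ hρb).symm, fun u y x hyx => ?_⟩
  obtain ⟨b, l⟩ := y
  obtain ⟨c, m⟩ := x
  let Y : ∀ b, R b := fun b => (P b).gen
  have hY : blockBasis P ⟨b, l⟩ = ε b * Y ^ (l : ℕ) := by
    rw [blockBasis_apply]
    ext d
    by_cases hd : d = b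
    · subst hd; simp [ε, Y]
    · simp [ε, Pi.single_eq_of_ne hd]
  have hYn : IsNilpotent (Y) := by
    refine ⟨∑ b, (k b + 1), funext fun b => ?_⟩
    simp only [Pi.pow_apply, Y, Pi.zero_apply]
    exact (P b).pow_eq_zero (lt_of_lt_of_le (Nat.lt_succ_self _)
      (Finset.single_le_sum (f := fun b => k b + 1) (fun _ _ => Nat.zero_le _) (Finset.mem_univ b)))
  have hYd : (P c).gen ∣ σ Y c := by
    refine (P c).dvd_of_isNilpotent ?_
    exact (hYn.map σ).map (Pi.evalRingHom R c)
  obtain ⟨r, hr⟩ := hYd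
  rw [blockBasis_repr] at hyx
  simp only [Pi.mul_apply, hY, map_mul, map_pow, Pi.pow_apply, hr, mul_pow] at hyx
  rw [show u c * (σ (ε b) c * ((P c).gen ^ (l : ℕ) * r ^ (l : ℕ))) =
    (P c).gen ^ (l : ℕ) * (u c * σ (ε b) c * r ^ (l : ℕ)) by ring] at hyx
  refine ⟨?_, ?_⟩
  · simp only
    rw [Equiv.eq_symm_apply, Equiv.ofBijective_apply]
    by_contra hb
    rw [hρ' b c hb] at hyx
    simp at hyx
  · by_contra hlm
    exact hyx ((P c).repr_pow_mul_eq_zero l _ m (not_le.1 hlm))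

end Blocks

section Isometries

variable {K : ℕ} {k : Fin K → ℕ}

lemma sigma_fin_ext {x z : Σ b, Fin (k b + 1)} (h1 : x.1 = z.1) (h2 : (x.2 : ℕ) = z.2) :
    x = z := by
  obtain ⟨b, l⟩ := x
  obtain ⟨c, m⟩ := z
  obtain rfl : b = c := h1
  exact congrArg (Sigma.mk b) (Fin.ext h2)

/-- A block-permuting, filtration-preserving isometry for a form that is standard on all blocks is
monomial. -/
lemma monomial_of_isometry {π : Equiv.Perm (Fin K)}
    {T H : Matrix (Σ b, Fin (k b + 1)) (Σ b, Fin (k b + 1)) ℂ}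
    (hT : ∀ y x, T y x ≠ 0 → x.1 = π y.1 ∧ (y.2 : ℕ) ≤ x.2)
    (hH : ∀ y y', y.1 = y'.1 → H y y' = if y = y' then 1 else 0)
    (hTH : T * H * Tᴴ = H) :
    (∀ b, k (π b) = k b) ∧ ∀ y, ∃ x t, x.1 = π y.1 ∧ (x.2 : ℕ) = y.2 ∧ t * star t = 1 ∧
      ∀ z, T y z = if z = x then t else 0 := by
  have hrow : ∀ y y', y.1 = y'.1 → ∑ x, T y x * star (T y' x) = if y = y' then 1 else 0 := by
    intro y y' hyy
    rw [← hH y y' hyy, ← hTH, Matrix.mul_apply]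
    refine Finset.sum_congr rfl fun x _ => ?_
    rw [Matrix.conjTranspose_apply, Matrix.mul_apply]
    by_cases hx : T y' x = 0
    · simp [hx]
    congr 1
    rw [Finset.sum_eq_single x]
    · rw [hH x x rfl, if_pos rfl, mul_one]
    · intro z _ hz
      by_cases hyz : T y z = 0
      · rw [hyz, zero_mul]
      · rw [hH z x (by rw [(hT y z hyz).1, (hT y' x hx).1, hyy]), if_neg hz, mul_zero]
    · simp
  have hne : ∀ y, ∃ x, T y x ≠ 0 := by
    intro y
    by_contra! h
    have := hrow y y rfl
    simp [h] at this
  have hle : ∀ b, k b ≤ k (π b) := by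
    intro b
    obtain ⟨x, hx⟩ := hne ⟨b, Fin.last _⟩
    obtain ⟨h1, h2⟩ := hT _ _ hx
    have h3 := x.2.2
    have h4 : k x.1 = k (π b) := congrArg k h1
    simp only [Fin.val_last] at h2
    omega
  have hk : ∀ b, k (π b) = k b := by
    have h1 : ∑ b, k b = ∑ b, k (π b) := (Equiv.sum_comp π k).symm
    intro b
    exact ((Finset.sum_eq_sum_iff_of_le fun b _ => hle b).1 h1 b (Finset.mem_univ b)).symm
  have hdiag : ∀ m : ℕ, ∀ y : (Σ b, Fin (k b + 1)), k y.1 - (y.2 : ℕ) = m →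
      ∀ x, T y x ≠ 0 → (x.2 : ℕ) = y.2 := by
    intro m
    induction m using Nat.strong_induction_on with
    | _ m ih =>
      intro y hy x hx
      obtain ⟨h1, h2⟩ := hT y x hx
      by_contra hne'
      have hlt : (y.2 : ℕ) < x.2 := lt_of_le_of_ne h2 (Ne.symm hne')
      have hxk : (x.2 : ℕ) < k y.1 + 1 := by
        have h3 : k x.1 = k (π y.1) := congrArg k h1
        rw [← hk y.1, ← h3]
        exact x.2.2
      let y' : Σ b, Fin (k b + 1) := ⟨y.1, ⟨x.2, hxk⟩⟩
      have hy' : ∀ z, T y' z ≠ 0 → z = x := by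
        intro z hz
        refine sigma_fin_ext ((hT y' z hz).1.trans h1.symm) ?_
        exact ih (k y.1 - (x.2 : ℕ)) (by omega) y' rfl z hz
      have hs : ∀ w : Σ b, Fin (k b + 1), ∑ z, T w z * star (T y' z) = T w x * star (T y' x) := by
        intro w
        refine Finset.sum_eq_single x (fun z _ hz => ?_) (by simp)
        rw [not_not.1 (mt (hy' z) hz), star_zero, mul_zero]
      have e1 := hrow y' y' rfl
      have e2 := hrow y y' rfl
      rw [hs, if_pos rfl] at e1
      rw [hs, if_neg] at e2
      · rcases mul_eq_zero.1 e2 with h | h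
        · exact hx h
        · rw [h, mul_zero] at e1
          exact zero_ne_one e1
      · intro h
        have h' : (y.2 : ℕ) = (y'.2 : ℕ) := by rw [← h]
        exact absurd h' hlt.ne
  refine ⟨hk, fun y => ?_⟩
  obtain ⟨x, hx⟩ := hne y
  have huniq : ∀ z, T y z ≠ 0 → z = x := fun z hz =>
    sigma_fin_ext ((hT y z hz).1.trans (hT y x hx).1.symm)
      ((hdiag _ y rfl z hz).trans (hdiag _ y rfl x hx).symm)
  refine ⟨x, T y x, (hT y x hx).1, hdiag _ y rfl x hx, ?_, fun z => ?_⟩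
  · have := hrow y y rfl
    rwa [if_pos rfl, Finset.sum_eq_single x (fun z _ hz => by
      rw [not_not.1 (mt (huniq z) hz), zero_mul]) (by simp)] at this
  · split_ifs with h
    · rw [h]
    · exact not_not.1 (mt (huniq z) h)

variable {A : Type} [CommRing A] [Algebra ℂ A] {ι κ : Type} [Fintype ι] [DecidableEq ι]
  [Fintype κ] [DecidableEq κ]

/-- The Gram matrix of the basis `E` for the inner product that makes `f` orthonormal. -/
def basisGram (E : Module.Basis ι ℂ A) (f : Module.Basis κ ℂ A) : Matrix ι ι ℂ :=
  (f.toMatrix E)ᵀ * ((f.toMatrix E)ᵀ)ᴴ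

lemma exists_basisGram_eq (E : Module.Basis ι ℂ A) (e : κ ≃ ι) {H : Matrix ι ι ℂ}
    (hH : H.PosDef) : ∃ f : Module.Basis κ ℂ A, basisGram E f = H := by
  obtain ⟨G, hG, rfl⟩ := exists_isUnit_conjTranspose_mul_self hH
  have hGd : IsUnit (Gᴴᵀ)⁻¹.det := by
    rw [Matrix.isUnit_nonsing_inv_det_iff, Matrix.det_transpose, Matrix.det_conjTranspose]
    exact ((Matrix.isUnit_iff_isUnit_det _).1 hG).star
  let f := E.map (Matrix.toLinearEquiv E (Gᴴᵀ)⁻¹ hGd)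
  have h1 : E.toMatrix f = (Gᴴᵀ)⁻¹ := by
    ext a b
    simp [f, Module.Basis.toMatrix_apply, Matrix.toLin_self, Finsupp.single_apply]
  have h2 : f.toMatrix E = Gᴴᵀ := by
    have := Module.Basis.toMatrix_mul_toMatrix_flip E f
    rw [h1] at this
    have h3 := Matrix.inv_eq_right_inv this
    rwa [Matrix.nonsing_inv_nonsing_inv _ ((Matrix.isUnit_nonsing_inv_det_iff).1 hGd),
      eq_comm] at h3
  refine ⟨f.reindex e.symm, ?_⟩
  have h4 : (f.reindex e.symm).toMatrix E = (Gᴴᵀ).submatrix e id := by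
    rw [← h2]
    ext a b
    simp [Module.Basis.toMatrix_apply]
  rw [basisGram, h4]
  ext a b
  simp only [Matrix.mul_apply, Matrix.transpose_apply, Matrix.submatrix_apply, id_eq,
    Matrix.conjTranspose_apply, star_star]
  exact Equiv.sum_comp e fun x => star (G x a) * G x b

lemma basisGram_isometry (E : Module.Basis ι ℂ A) (f : Module.Basis κ ℂ A) {S : Matrix κ κ ℂ}
    (hS : S ∈ Matrix.unitaryGroup κ ℂ) :
    (LinearMap.toMatrix E E (f.constr ℂ fun y => ∑ x, S y x • f x))ᵀ * basisGram E f *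
      ((LinearMap.toMatrix E E (f.constr ℂ fun y => ∑ x, S y x • f x))ᵀ)ᴴ = basisGram E f := by
  have h1 : LinearMap.toMatrix f f (f.constr ℂ fun y => ∑ x, S y x • f x) = Sᵀ := by
    ext x y
    rw [LinearMap.toMatrix_apply, Module.Basis.constr_basis, Matrix.transpose_apply,
      Module.Basis.repr_sum_self]
  rw [← basis_toMatrix_mul_linearMap_toMatrix_mul_basis_toMatrix (b' := f) (c' := f), h1]
  have h2 : (f.toMatrix E) * (E.toMatrix f) = 1 := Module.Basis.toMatrix_mul_toMatrix_flip _ _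
  have h3 : (E.toMatrix f)ᵀ * (f.toMatrix E)ᵀ = 1 := by
    rw [← Matrix.transpose_mul, h2, Matrix.transpose_one]
  rw [basisGram]
  simp only [Matrix.transpose_mul, Matrix.transpose_transpose]
  set Q := (f.toMatrix E)ᵀ
  set g := (E.toMatrix f)ᵀ
  have h4 : S * Sᴴ = 1 := Matrix.mem_unitaryGroup_iff.1 hS
  calc Q * (S * g) * (Q * Qᴴ) * (Q * (S * g))ᴴ
      = Q * S * (g * Q) * (g * Q)ᴴ * Sᴴ * Qᴴ := by
        simp only [Matrix.conjTranspose_mul, Matrix.mul_assoc]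
    _ = Q * (S * Sᴴ) * Qᴴ := by
        rw [h3]
        simp only [Matrix.conjTranspose_one, Matrix.mul_one, Matrix.mul_assoc]
    _ = Q * Qᴴ := by rw [h4, Matrix.mul_one]

lemma eq_smul_one_of_constr_eq (E : Module.Basis ι ℂ A) (f : Module.Basis κ ℂ A)
    {S : Matrix κ κ ℂ} {t : ℂ}
    (h : ∀ y, f.constr ℂ (fun y => ∑ x, S y x • f x) (E y) = t • E y) : S = t • 1 := by
  have h1 : f.constr ℂ (fun y => ∑ x, S y x • f x) = t • LinearMap.id :=
    E.ext fun y => by simpa using h y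
  ext y x
  have h2 := congrArg (fun s : A →ₗ[ℂ] A => f.repr (s (f y)) x) h1
  simp only [Module.Basis.constr_basis, Module.Basis.repr_sum_self, LinearMap.smul_apply,
    LinearMap.id_apply, map_smul, Finsupp.smul_apply, Module.Basis.repr_self] at h2
  rw [h2, Matrix.smul_apply, Matrix.one_apply, Finsupp.single_apply]

end Isometries

section Rigidity

variable {n : ℕ} {ι : Type} [Fintype ι] [DecidableEq ι]

lemma localOp_smul_one (z : Fin n → ℂ) (Φ : QState n ι) :
    localOp (fun j => z j • (1 : Matrix ι ι ℂ)) Φ = (∏ j, z j) • Φ := by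
  have h : kron (fun j => z j • (1 : Matrix ι ι ℂ)) = (∏ j, z j) • (1 : Matrix _ _ ℂ) := by
    rw [← kron_one]
    ext y x
    simp [kron, Finset.prod_mul_distrib]
  rw [localOp_eq_mulVec, h, Matrix.smul_mulVec, Matrix.one_mulVec]

/-- It suffices to control the unitary components of quasi-unitary symmetries. -/
lemma quasiUnitarilyRigid_of_scalar [Nonempty ι] {Φ : QState n ι} (hΦ : FullyEntangled Φ)
    (h : ∀ (i : Fin n) (S : Fin n → Matrix ι ι ℂ) (c : ℂ), c ≠ 0 →
      (∀ j, j ≠ i → S j ∈ Matrix.unitaryGroup ι ℂ) → localOp S Φ = c • Φ →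
      ∀ j, j ≠ i → ∃ z : ℂ, S j = z • 1) : QuasiUnitarilyRigid Φ := by
  intro i S c hc hS hsym
  choose! z hz using h i S c hc hS hsym
  have hz0 : ∀ j, j ≠ i → z j ≠ 0 := by
    intro j hj h0
    have := isUnit_of_mem_unitaryGroup (hS j hj)
    rw [hz j hj, h0, zero_smul] at this
    exact not_isUnit_zero this
  set w := ∏ j, Function.update z i 1 j with hw
  have hw0 : w ≠ 0 := Finset.prod_ne_zero_iff.2 fun j _ => by
    by_cases hj : j = i
    · subst hj; simp
    · simpa [hj] using hz0 j hj
  refine ⟨c / w, hΦ.localOp_cancel (i := i) (U := S)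
    (fun j hj => isUnit_of_mem_unitaryGroup (hS j hj)) ?_⟩
  rw [Function.update_eq_self, hsym, localOp_update_smul]
  have : Function.update S i 1 = fun j => Function.update z i 1 j • (1 : Matrix ι ι ℂ) := by
    ext1 j
    by_cases hj : j = i
    · subst hj; simp
    · simp [hj, hz j hj]
  rw [this, localOp_smul_one, ← hw, smul_smul, div_mul_cancel₀ _ hw0]

end Rigidity

section Existence

lemma monomial_of_symmetry {K : ℕ} {k : Fin K → ℕ} {R : Fin K → Type} [∀ b, CommRing (R b)]
    [∀ b, Algebra ℂ (R b)] {κ : Type} [Fintype κ] [DecidableEq κ]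
    (P : ∀ b, NilpotentPowerBasis (R b) (k b)) (f : Module.Basis κ ℂ (∀ b, R b))
    (hH : ∀ y y', y.1 = y'.1 → basisGram (blockBasis P) f y y' = if y = y' then 1 else 0)
    {σ : (∀ b, R b) →ₐ[ℂ] (∀ b, R b)} (hσ : Function.Injective σ) {u : ∀ b, R b}
    {S : Matrix κ κ ℂ} (hS : S ∈ Matrix.unitaryGroup κ ℂ)
    (hs : ∀ a, f.constr ℂ (fun y => ∑ x, S y x • f x) a = u * σ a) :
    ∃ π : Equiv.Perm (Fin K), (∀ b, k (π b) = k b) ∧ ∀ y, ∃ x t, x.1 = π y.1 ∧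
      (x.2 : ℕ) = y.2 ∧ t * star t = 1 ∧
      ∀ z, (blockBasis P).repr (u * σ (blockBasis P y)) z = if z = x then t else 0 := by
  obtain ⟨π, hπ⟩ := exists_perm_of_algHom P σ hσ
  have hT : ∀ y z, (LinearMap.toMatrix (blockBasis P) (blockBasis P)
      (f.constr ℂ fun y => ∑ x, S y x • f x))ᵀ y z =
        (blockBasis P).repr (u * σ (blockBasis P y)) z := by
    intro y z
    rw [Matrix.transpose_apply, LinearMap.toMatrix_apply, hs]
  obtain ⟨h1, h2⟩ := monomial_of_isometry (π := π) (fun y x hyx => hπ u y x (by rwa [hT] at hyx))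
    hH (basisGram_isometry (blockBasis P) f hS)
  refine ⟨π, h1, fun y => ?_⟩
  obtain ⟨x, t, hx1, hx2, ht, hz⟩ := h2 y
  exact ⟨x, t, hx1, hx2, ht, fun z => by rw [← hT, hz]⟩

lemma posDef_of_diagonally_dominant {ι : Type} [Fintype ι] [DecidableEq ι] {H : Matrix ι ι ℂ}
    (hH : H.IsHermitian) (h1 : ∀ i, H i i = 1) (hr : ∀ i, ∑ j ∈ Finset.univ.erase i, ‖H i j‖ < 1) :
    H.PosDef := by
  rw [hH.posDef_iff_eigenvalues_pos]
  intro i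
  have hev : Module.End.HasEigenvalue (Matrix.toLin' H) (hH.eigenvalues i : ℂ) := by
    refine Module.End.hasEigenvalue_of_hasEigenvector (x := (hH.eigenvectorBasis i).ofLp) ⟨?_, ?_⟩
    · rw [Module.End.mem_eigenspace_iff, Matrix.toLin'_apply, hH.mulVec_eigenvectorBasis]
      ext a
      simp
    · intro h
      have h0 := hH.eigenvectorBasis.orthonormal.ne_zero i
      exact h0 (by ext a; exact congrFun h a)
  obtain ⟨j, hj⟩ := eigenvalue_mem_ball hev
  rw [h1, mem_closedBall_iff_norm] at hj
  have h2 := lt_of_le_of_lt hj (hr j)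
  have h3 : ‖(hH.eigenvalues i : ℂ) - 1‖ = |hH.eigenvalues i - 1| := by
    rw [← Complex.ofReal_one, ← Complex.ofReal_sub, Complex.norm_real, Real.norm_eq_abs]
  rw [h3, abs_lt] at h2
  linarith [h2.1]

/-- Positive definite matrices that are standard on all blocks and whose other entries have
moduli depending injectively on the position. -/
lemma exists_posDef_generic {K : ℕ} (k : Fin K → ℕ) :
    ∃ H : Matrix (Σ b, Fin (k b + 1)) (Σ b, Fin (k b + 1)) ℂ, H.PosDef ∧
      (∀ y y', y.1 = y'.1 → H y y' = if y = y' then 1 else 0) ∧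
      ∃ ν : Sym2 (Σ b, Fin (k b + 1)) → ℝ, Function.Injective ν ∧ (∀ p, 0 < ν p) ∧
        ∀ y y', y.1 ≠ y'.1 → H y y' = ν s(y, y') := by
  classical
  obtain ⟨c, hc⟩ := Countable.exists_injective_nat (Sym2 (Σ b, Fin (k b + 1)))
  set N := Fintype.card (Σ b, Fin (k b + 1)) with hN
  let ν : Sym2 (Σ b, Fin (k b + 1)) → ℝ := fun p => ((N + 1 + c p : ℕ) : ℝ)⁻¹
  have hνpos : ∀ p, 0 < ν p := fun p => by
    simp only [ν]
    exact inv_pos.2 (by exact_mod_cast (by omega : 0 < N + 1 + c p))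
  have hνle : ∀ p, ν p ≤ ((N + 1 : ℕ) : ℝ)⁻¹ := fun p => by
    refine inv_anti₀ (by positivity) ?_
    exact_mod_cast (by omega : N + 1 ≤ N + 1 + c p)
  have hνinj : Function.Injective ν := by
    intro p q hpq
    simp only [ν, inv_inj, Nat.cast_inj] at hpq
    exact hc (by omega)
  let H : Matrix (Σ b, Fin (k b + 1)) (Σ b, Fin (k b + 1)) ℂ := fun y y' =>
    if y = y' then 1 else if y.1 = y'.1 then 0 else (ν s(y, y') : ℂ)
  have hHd : ∀ y y', H y y' = if y = y' then 1 else if y.1 = y'.1 then 0 else (ν s(y, y') : ℂ) :=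
    fun _ _ => rfl
  clear_value H
  refine ⟨H, posDef_of_diagonally_dominant ?_ (fun y => by simp [hHd]) fun y => ?_,
    fun y y' hy => ?_,
    ν, hνinj, hνpos, fun y y' hy => ?_⟩
  · ext y y'
    rw [Matrix.conjTranspose_apply, hHd, hHd]
    by_cases h : y = y'
    · simp [h]
    by_cases h' : y.1 = y'.1
    · simp [h']
      simp [Ne.symm h, h]
    · rw [if_neg (Ne.symm h), if_neg (Ne.symm h'), if_neg h, if_neg h', Sym2.eq_swap]
      simp
  · calc ∑ y' ∈ Finset.univ.erase y, ‖H y y'‖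
        ≤ ∑ y' ∈ Finset.univ.erase y, ((N + 1 : ℕ) : ℝ)⁻¹ := by
          refine Finset.sum_le_sum fun y' hy' => ?_
          rw [hHd, if_neg (Finset.ne_of_mem_erase hy').symm]
          split_ifs
          · simp
            positivity
          · rw [Complex.norm_real, Real.norm_of_nonneg (hνpos _).le]
            exact hνle _
      _ ≤ N * ((N + 1 : ℕ) : ℝ)⁻¹ := by
          rw [Finset.sum_const, nsmul_eq_mul]
          gcongr
          rw [hN]
          exact Finset.card_le_univ _
      _ < 1 := by
          rw [← div_eq_mul_inv, div_lt_one (by positivity)]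
          exact_mod_cast Nat.lt_succ_self N
  · rw [hHd]
    by_cases h : y = y'
    · simp [h]
    · simp [h, hy]
  · rw [hHd, if_neg (fun h => hy (by rw [h])), if_neg hy]

/-- A permutation of the basis vectors that permutes the blocks and keeps the degrees is trivial
as soon as it preserves all pairs from different blocks, except for two one-dimensional blocks. -/
lemma eq_self_of_pairs {K : ℕ} {k : Fin K → ℕ} {π : Equiv.Perm (Fin K)}
    (hcard : 3 ≤ Fintype.card (Σ b, Fin (k b + 1))) (hk : ∀ b, k (π b) = k b)
    {θ : (Σ b, Fin (k b + 1)) → (Σ b, Fin (k b + 1))}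
    (h1 : ∀ y, (θ y).1 = π y.1) (h2 : ∀ y, ((θ y).2 : ℕ) = y.2)
    (hp : ∀ y y', y.1 ≠ y'.1 → s(θ y, θ y') = s(y, y')) (y) : θ y = y := by
  have hπ : ∀ b, π b = b := by
    intro b
    by_contra hb
    have hall : ∀ y : (Σ b, Fin (k b + 1)), y.1 = b →
        ∀ y' : (Σ b, Fin (k b + 1)), y'.1 ≠ b → θ y = y' := by
      intro y hy y' hy'
      have := hp y y' (by rw [hy]; exact hy'.symm)
      rw [Sym2.eq_iff] at this
      rcases this with h | h
      · have h3 := h1 y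
        rw [h.1, hy] at h3
        exact absurd h3.symm hb
      · exact h.1
    let y₀ : Σ b, Fin (k b + 1) := ⟨b, 0⟩
    have hk0 : k b = 0 := by
      by_contra hkb
      let y₁ : Σ b, Fin (k b + 1) := ⟨π b, ⟨1, by rw [hk]; omega⟩⟩
      have h3 := hall y₀ rfl y₁ hb
      have h4 := h2 y₀
      rw [h3] at h4
      simp [y₀, y₁] at h4
    have hsub : (Finset.univ : Finset (Σ b, Fin (k b + 1))) ⊆ {y₀, θ y₀} := by
      intro y _
      simp only [Finset.mem_insert, Finset.mem_singleton]
      by_cases hy : y.1 = b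
      · left
        refine sigma_fin_ext hy ?_
        have h3 : k y.1 = k b := congrArg k hy
        have := y.2.2
        simp only [y₀, Fin.val_zero]
        omega
      · right
        exact (hall y₀ rfl y hy).symm
    have := (Finset.card_le_card hsub).trans Finset.card_le_two
    rw [Finset.card_univ] at this
    omega
  exact sigma_fin_ext ((h1 y).trans (hπ _)) (h2 y)

variable {n : ℕ}

lemma isSymmetric_formState {A ι : Type} [CommRing A] [Algebra ℂ A] [Fintype ι] [DecidableEq ι]
    (φ : A →ₗ[ℂ] ℂ) (f : ι → A) : IsSymmetric (formState φ fun _ : Fin n => f) := by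
  intro i j x
  simp only [formState, Function.comp_apply]
  rw [Equiv.prod_comp (Equiv.swap i j) fun o => f (x o)]

open Polynomial in
theorem exists_symmetric_weaklyIsolated (hn : 3 ≤ n) {K : ℕ} (k : Fin K → ℕ) (hK : 2 ≤ K)
    (hcard : 3 ≤ Fintype.card (Σ b, Fin (k b + 1))) {κ : Type} [Fintype κ] [DecidableEq κ]
    (e : κ ≃ Σ b, Fin (k b + 1)) :
    ∃ Φ : QState n κ, SLOCCEquivalent Φ (blockState n k) ∧ IsSymmetric Φ ∧ WeaklyIsolated Φ := by
  have : NeZero n := ⟨by omega⟩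
  have : Nonempty (Σ b, Fin (k b + 1)) := Fintype.card_pos_iff.1 (by omega)
  have : Nonempty κ := e.nonempty
  choose P _ using fun b => exists_nilpotentPowerBasis_quotient (irreducible_X (R := ℂ)) (k b)
  obtain ⟨H, hHpd, hHblock, ν, hν, hνpos, hHν⟩ := exists_posDef_generic k
  obtain ⟨f, hf⟩ := exists_basisGram_eq (blockBasis P) e hHpd
  have hFE : FullyEntangled (formState (blockForm P) fun _ : Fin n => f) :=
    fullyEntangled_formState hn (blockForm_nondegenerate P) fun _ => f
  refine ⟨formState (blockForm P) fun _ => f, ?_, isSymmetric_formState _ _,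
    (quasiUnitarilyRigid_of_scalar hFE fun i S c hc hS hsym j hj => ?_).weaklyIsolated hFE⟩
  · rw [blockState_eq_formState P]
    exact sloccEquivalent_formState _ (fun _ => f) fun _ => blockBasis P
  have : FiniteDimensional ℂ (∀ b, ℂ[X] ⧸ Ideal.span {(X : ℂ[X]) ^ (k b + 1)}) :=
    (blockBasis P).finiteDimensional_of_finite
  obtain ⟨σ, u, hσ, hs⟩ := exists_algHom_of_symmetry hn (blockForm_nondegenerate P) hc
    (symmetry_of_localOp_eq (f := fun _ => f) hsym)
  obtain ⟨π, hk, hmon⟩ := monomial_of_symmetry P f (fun y y' h => by rw [hf, hHblock y y' h]) hσ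
    (hS j hj) (hs j)
  choose θ t h1 h2 ht hz using hmon
  have hE : ∀ y, u j * σ (blockBasis P y) = t y • blockBasis P (θ y) := by
    intro y
    refine (blockBasis P).repr.injective (Finsupp.ext fun z => ?_)
    rw [hz, map_smul, Finsupp.smul_apply, Module.Basis.repr_self, Finsupp.single_apply]
    simp [eq_comm]
  have hHθ : ∀ y y', H y y' = t y * star (t y') * H (θ y) (θ y') := by
    intro y y'
    have h3 := basisGram_isometry (blockBasis P) f (hS j hj)
    have hT : ∀ y z, (LinearMap.toMatrix (blockBasis P) (blockBasis P)
        (f.constr ℂ fun y => ∑ x, S j y x • f x))ᵀ y z = if z = θ y then t y else 0 := by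
      intro y z
      rw [Matrix.transpose_apply, LinearMap.toMatrix_apply, hs, hz]
    rw [hf] at h3
    conv_lhs => rw [← h3]
    simp only [Matrix.mul_apply, Matrix.conjTranspose_apply, hT]
    rw [Finset.sum_eq_single (θ y'), Finset.sum_eq_single (θ y)]
    · simp only [if_pos]
      ring
    · intro z _ hz'
      rw [if_neg hz', zero_mul]
    · simp
    · intro z _ hz'
      rw [if_neg hz', star_zero, mul_zero]
    · simp
  have hnorm : ∀ y, ‖t y‖ = 1 := by
    intro y
    have h3 := congrArg norm (ht y)
    rw [norm_mul, norm_star, norm_one, ← sq] at h3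
    exact (pow_eq_one_iff_of_nonneg (norm_nonneg _) two_ne_zero).1 h3
  have hθ : ∀ y, θ y = y := by
    refine eq_self_of_pairs hcard hk h1 h2 fun y y' hy => hν ?_
    have h3 := congrArg norm (hHθ y y')
    have h4 : (θ y).1 ≠ (θ y').1 := by
      rw [h1, h1]
      exact fun h => hy (π.injective h)
    rw [norm_mul, norm_mul, norm_star, hnorm, hnorm, hHν y y' hy, hHν _ _ h4, Complex.norm_real,
      Complex.norm_real, Real.norm_of_nonneg (hνpos _).le, Real.norm_of_nonneg (hνpos _).le] at h3
    linarith
  have ht1 : ∀ y y', y.1 ≠ y'.1 → t y = t y' := by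
    intro y y' hy
    have h3 := hHθ y y'
    rw [hθ, hθ, hHν y y' hy] at h3
    have h4 : (ν s(y, y') : ℂ) ≠ 0 := by exact_mod_cast (hνpos _).ne'
    have h5 : t y * star (t y') = 1 := by
      refine mul_right_cancel₀ h4 ?_
      rw [← h3, one_mul]
    calc t y = t y * (t y' * star (t y')) := by rw [ht, mul_one]
      _ = t y * star (t y') * t y' := by ring
      _ = t y' := by rw [h5, one_mul]
  have hconst : ∀ y y', t y = t y' := by
    intro y y'
    by_cases hy : y.1 = y'.1
    · have : Nontrivial (Fin K) := Fin.nontrivial_iff_two_le.2 hK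
      obtain ⟨b, hb⟩ := exists_ne y.1
      rw [ht1 y ⟨b, 0⟩ hb.symm, ht1 ⟨b, 0⟩ y' (hy ▸ hb)]
    · exact ht1 y y' hy
  obtain ⟨y₀⟩ := ‹Nonempty (Σ b, Fin (k b + 1))›
  refine ⟨t y₀, eq_smul_one_of_constr_eq (blockBasis P) f fun y => ?_⟩
  rw [hs, hE, hθ, hconst y y₀]

lemma eq_of_two_eigenvectors {A : Type} [CommRing A] [Algebra ℂ A] {Y X r : A} {m : ℕ}
    (hY : Y ^ (m + 2) ≠ 0) (hY' : Y ^ (m + 3) = 0) (hX : X = Y * r) {a b α β : ℂ} (hab : a ≠ b)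
    (hα : α ≠ 0) (h1 : X + a • X ^ 2 = α • (Y + a • Y ^ 2))
    (h2 : X + b • X ^ 2 = β • (Y + b • Y ^ 2)) : X = Y := by
  have h3 : (a - b) • X ^ 2 = (α - β) • Y + (α * a - β * b) • Y ^ 2 := by
    have h4 : (a - b) • X ^ 2 = X + a • X ^ 2 - (X + b • X ^ 2) := by module
    rw [h4, h1, h2]
    module
  have hαβ : α = β := by
    have h4 := congrArg (fun z => z * Y ^ (m + 1)) h3
    simp only [add_mul, smul_mul_assoc] at h4
    rw [hX, show (Y * r) ^ 2 * Y ^ (m + 1) = Y ^ (m + 3) * r ^ 2 by ring,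
      show Y ^ 2 * Y ^ (m + 1) = Y ^ (m + 3) by ring, show Y * Y ^ (m + 1) = Y ^ (m + 2) by ring,
      hY', zero_mul, smul_zero, smul_zero, add_zero, eq_comm, smul_eq_zero] at h4
    exact sub_eq_zero.1 (h4.resolve_right hY)
  subst hαβ
  have hX2 : X ^ 2 = α • Y ^ 2 := by
    refine smul_right_injective A (sub_ne_zero.2 hab) ?_
    simp only
    rw [h3, smul_smul]
    module
  have hXα : X = α • Y := by
    rw [hX2] at h1
    have h5 : X + a • α • Y ^ 2 - a • α • Y ^ 2 = α • (Y + a • Y ^ 2) - a • α • Y ^ 2 := by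
      rw [h1]
    rw [add_sub_cancel_right] at h5
    rw [h5]
    module
  have hY2 : Y ^ 2 ≠ 0 := by
    intro h
    exact hY (by rw [pow_add, h, mul_zero])
  have hα1 : α = 1 := by
    have h6 : (α * (α - 1)) • Y ^ 2 = 0 := by
      have h7 : α ^ 2 • Y ^ 2 = α • Y ^ 2 := by rw [← hX2, hXα, smul_pow]
      have : (α * (α - 1)) • Y ^ 2 = α ^ 2 • Y ^ 2 - α • Y ^ 2 := by module
      rw [this, h7, sub_self]
    have h8 := (smul_eq_zero.1 h6).resolve_right hY2
    exact sub_eq_zero.1 ((mul_eq_zero.1 h8).resolve_left hα)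
  rw [hXα, hα1, one_smul]

open Polynomial in
theorem exists_weaklyIsolated_single (hn : 3 ≤ n) (k : Fin 1 → ℕ) (hk : 2 ≤ k 0) {κ : Type}
    [Fintype κ] [DecidableEq κ] (e : κ ≃ Σ b, Fin (k b + 1)) :
    ∃ Φ : QState n κ, SLOCCEquivalent Φ (blockState n k) ∧ WeaklyIsolated Φ := by
  have : NeZero n := ⟨by omega⟩
  have : Nonempty κ := ⟨e.symm ⟨0, 0⟩⟩
  choose P hP using fun b => exists_nilpotentPowerBasis_quotient (irreducible_X (R := ℂ)) (k b)
  have hPj : ∀ (j : Fin n) (b : Fin 1),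
      ∃ Q : NilpotentPowerBasis (ℂ[X] ⧸ Ideal.span {(X : ℂ[X]) ^ (k b + 1)}) (k b),
        Q.gen = (P b).gen + ((j : ℕ) : ℂ) • (P b).gen ^ 2 := by
    intro j b
    have hfac : (P b).gen + ((j : ℕ) : ℂ) • (P b).gen ^ 2 =
        (P b).gen * (1 + ((j : ℕ) : ℂ) • (P b).gen) := by
      rw [mul_add, mul_one, mul_smul_comm, sq]
    have hu : IsUnit (1 + ((j : ℕ) : ℂ) • (P b).gen) :=
      IsNilpotent.isUnit_one_add ⟨k b + 1, by rw [_root_.smul_pow, (P b).gen_pow, smul_zero]⟩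
    refine NilpotentPowerBasis.nonempty_of_pow_ne_zero _ ?_ ?_ ?_
    · rw [Module.finrank_eq_card_basis (P b).basis, Fintype.card_fin]
    · rw [hfac, mul_pow, Ne, (hu.pow _).mul_left_eq_zero]
      exact (P b).gen_pow_ne_zero
    · rw [hfac, mul_pow, (P b).gen_pow, zero_mul]
  choose Q hQ using hPj
  choose f hf using fun j => exists_basisGram_eq (blockBasis (Q j)) e Matrix.PosDef.one
  have hFE : FullyEntangled (formState (blockForm P) fun j : Fin n => f j) :=
    fullyEntangled_formState hn (blockForm_nondegenerate P) f
  refine ⟨formState (blockForm P) fun j => f j, ?_,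
    (quasiUnitarilyRigid_of_scalar hFE fun i S c hc hS hsym j hj => ?_).weaklyIsolated hFE⟩
  · rw [blockState_eq_formState P]
    exact sloccEquivalent_formState _ f fun _ => blockBasis P
  have : FiniteDimensional ℂ (∀ b, ℂ[X] ⧸ Ideal.span {(X : ℂ[X]) ^ (k b + 1)}) :=
    (blockBasis P).finiteDimensional_of_finite
  obtain ⟨σ, u, hσ, hs⟩ := exists_algHom_of_symmetry hn (blockForm_nondegenerate P) hc
    (symmetry_of_localOp_eq hsym)
  let Y : ∀ b, ℂ[X] ⧸ Ideal.span {(X : ℂ[X]) ^ (k b + 1)} := fun b => (P b).gen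
  let G : Fin n → ∀ b, ℂ[X] ⧸ Ideal.span {(X : ℂ[X]) ^ (k b + 1)} :=
    fun j => Y + ((j : ℕ) : ℂ) • Y ^ 2
  have hbasis : ∀ j y, blockBasis (Q j) y = G j ^ (y.2 : ℕ) := by
    intro j y
    obtain ⟨b, l⟩ := y
    ext b'
    obtain rfl : b' = b := Subsingleton.elim _ _
    rw [blockBasis_apply, Pi.single_eq_same, hQ]
    rfl
  obtain ⟨m, hm⟩ := Nat.exists_eq_add_of_le' hk
  have hY : Y ^ (m + 2) ≠ 0 := by
    intro h
    have h1 := congrFun h 0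
    simp only [Pi.pow_apply, Y, Pi.zero_apply] at h1
    rw [← hm] at h1
    exact (P 0).gen_pow_ne_zero h1
  have hY' : Y ^ (m + 3) = 0 := by
    ext b
    obtain rfl : b = 0 := Subsingleton.elim _ _
    simp only [Pi.pow_apply, Y, Pi.zero_apply]
    exact (P 0).pow_eq_zero (by omega)
  have heig : ∀ j, j ≠ i → (∃ t : ℂ, (u j).val = t • 1) ∧
      ∃ α : ℂ, α ≠ 0 ∧ σ (G j) = α • G j := by
    intro j hj
    obtain ⟨π, -, hmon⟩ := monomial_of_symmetry (Q j) (f j)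
      (fun y y' _ => by rw [hf, Matrix.one_apply]) hσ (hS j hj) (hs j)
    have hE : ∀ y, ∃ t : ℂ, t ≠ 0 ∧
        u j * σ (blockBasis (Q j) y) = t • blockBasis (Q j) y := by
      intro y
      obtain ⟨x, t, h1, h2, ht, hz⟩ := hmon y
      obtain rfl : x = y := sigma_fin_ext (Subsingleton.elim _ _) h2
      refine ⟨t, left_ne_zero_of_mul_eq_one ht,
        (blockBasis (Q j)).repr.injective (Finsupp.ext fun z => ?_)⟩
      rw [hz, map_smul, Finsupp.smul_apply, Module.Basis.repr_self, Finsupp.single_apply]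
      simp [eq_comm]
    obtain ⟨t₀, ht₀, h0⟩ := hE ⟨0, 0⟩
    obtain ⟨t₁, ht₁, h1⟩ := hE ⟨0, ⟨1, by omega⟩⟩
    rw [hbasis] at h0 h1
    simp only [Fin.val_zero, pow_zero, map_one, mul_one, pow_one] at h0 h1
    refine ⟨⟨t₀, h0⟩, t₀⁻¹ * t₁, mul_ne_zero (inv_ne_zero ht₀) ht₁, ?_⟩
    rw [h0, smul_mul_assoc, one_mul] at h1
    rw [mul_smul, ← h1, smul_smul, inv_mul_cancel₀ ht₀, one_smul]
  obtain ⟨l, hil, hjl⟩ := exists_third hn i j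
  obtain ⟨⟨t, ht⟩, α, hα, hGj⟩ := heig j hj
  obtain ⟨-, β, -, hGl⟩ := heig l hil.symm
  have hσY : σ Y = Y := by
    have hdvd : ∀ b, (P b).gen ∣ σ Y b := fun b => (P b).dvd_of_isNilpotent <| by
      have : IsNilpotent Y := ⟨_, hY'⟩
      exact (this.map σ).map (Pi.evalRingHom _ b)
    choose r hr using hdvd
    refine eq_of_two_eigenvectors hY hY' (r := r) (funext hr) (a := ((j : ℕ) : ℂ))
      (b := ((l : ℕ) : ℂ)) ?_ hα ?_ (β := β) ?_
    · exact fun h => hjl (Fin.ext (Nat.cast_injective h))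
    · rw [← hGj]
      simp [G]
    · rw [← hGl]
      simp [G]
  refine ⟨t, eq_smul_one_of_constr_eq (blockBasis (Q j)) (f j) fun y => ?_⟩
  rw [hs, hbasis, ht, map_pow, map_add, map_smul, map_pow, hσY, smul_mul_assoc, one_mul]

end Existence

section CyclicDecomposition

open Polynomial Module

lemma exists_nilpotentPowerBasis_of_eq {I : Ideal ℂ[X]} {p : ℂ[X]} {k : ℕ} (hp : Irreducible p)
    (hI : I = Ideal.span {p ^ (k + 1)}) : Nonempty (NilpotentPowerBasis (ℂ[X] ⧸ I) k) := by
  subst hI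
  exact ⟨(exists_nilpotentPowerBasis_quotient hp k).choose⟩

/-- An endomorphism with one-dimensional eigenspaces is multiplication by `X` on a product of
quotients of `ℂ[X]` by powers of pairwise coprime irreducible polynomials. -/
theorem exists_cyclic_decomposition {V : Type} [AddCommGroup V] [Module ℂ V]
    [FiniteDimensional ℂ V] (C : V →ₗ[ℂ] V)
    (hC : ∀ μ : ℂ, finrank ℂ (Module.End.eigenspace C μ) ≤ 1) :
    ∃ (K : ℕ) (k : Fin K → ℕ) (p : Fin K → ℂ[X]) (I : Fin K → Ideal ℂ[X]),
      (∀ b, Irreducible (p b)) ∧ (∀ b, I b = Ideal.span {p b ^ (k b + 1)}) ∧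
      Pairwise (Function.onFun IsCoprime I) ∧
      ∃ ψ : (∀ b, ℂ[X] ⧸ I b) ≃ₗ[ℂ] V, ∀ a, ψ ((X : ℂ[X]) • a) = C (ψ a) := by
  classical
  obtain ⟨ι', _, p, hp, e, ⟨φ⟩⟩ := Module.equiv_directSum_of_isTorsion
    (Module.AEval.isTorsion_of_finiteDimensional ℂ V C)
  let M : ι' → Type := fun i => ℂ[X] ⧸ (ℂ[X] ∙ p i ^ e i)
  let g : Fin (Fintype.card {i // e i ≠ 0}) ≃ {i // e i ≠ 0} := (Fintype.equivFin _).symm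
  let I : Fin (Fintype.card {i // e i ≠ 0}) → Ideal ℂ[X] := fun b => ℂ[X] ∙ p (g b) ^ e (g b)
  have hI : ∀ b, I b = Ideal.span {p (g b) ^ (e (g b) - 1 + 1)} := by
    intro b
    rw [Nat.sub_add_cancel (Nat.one_le_iff_ne_zero.2 (g b).2)]
  let r : (∀ i, M i) →ₗ[ℂ[X]] (∀ b, ℂ[X] ⧸ I b) := LinearMap.pi fun b => LinearMap.proj (g b).1
  have hginj : ∀ b b', (g b).1 = (g b').1 → b = b' := fun b b' h => g.injective (Subtype.ext h)
  have hr : Function.Bijective r := by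
    constructor
    · intro x y hxy
      ext i
      by_cases hi : e i = 0
      · have : Subsingleton (M i) := by
          refine Ideal.Quotient.subsingleton_iff.2 ?_
          rw [hi, pow_zero]
          exact Ideal.span_singleton_one
        exact Subsingleton.elim _ _
      · obtain ⟨b, rfl⟩ : ∃ b, (g b).1 = i := ⟨g.symm ⟨i, hi⟩, by rw [Equiv.apply_symm_apply]⟩
        exact congrFun hxy b
    · intro y
      refine ⟨∑ b, Pi.single (M := M) (g b).1 (y b), ?_⟩
      ext b
      simp only [r, LinearMap.pi_apply, LinearMap.proj_apply, Finset.sum_apply]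
      rw [Finset.sum_eq_single b]
      · exact Pi.single_eq_same _ _
      · intro b' _ hb'
        exact Pi.single_eq_of_ne (fun h => hb' (hginj _ _ h.symm)) _
      · simp
  let Ψ : Module.AEval ℂ V C ≃ₗ[ℂ[X]] (∀ b, ℂ[X] ⧸ I b) :=
    (φ.trans (DirectSum.linearEquivFunOnFintype ℂ[X] ι' M)).trans (LinearEquiv.ofBijective r hr)
  let ψ : (∀ b, ℂ[X] ⧸ I b) ≃ₗ[ℂ] V :=
    (Ψ.symm.restrictScalars ℂ).trans (Module.AEval.of ℂ V C).symm
  have hψX : ∀ a, ψ ((X : ℂ[X]) • a) = C (ψ a) := by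
    intro a
    simp only [ψ, LinearEquiv.trans_apply, LinearEquiv.restrictScalars_apply, map_smul]
    rw [Module.AEval.of_symm_X_smul]
    rfl
  refine ⟨_, fun b => e (g b) - 1, fun b => p (g b), I, fun b => hp _, hI, fun b b' hbb' => ?_,
    ψ, hψX⟩
  rw [Function.onFun, hI, hI, Ideal.isCoprime_span_singleton_iff]
  refine IsCoprime.pow ?_
  rw [(hp (g b)).coprime_iff_not_dvd]
  intro hdvd
  have hass : Associated (p (g b)) (p (g b')) := (hp _).associated_of_dvd (hp _) hdvd
  obtain ⟨μ, hμ⟩ := IsAlgClosed.exists_root (p (g b)) (by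
    rw [IsAlgClosed.degree_eq_one_of_irreducible ℂ (hp _)]
    exact one_ne_zero)
  have hassX : Associated (p (g b)) (X - Polynomial.C μ) :=
    ((irreducible_X_sub_C μ).associated_of_dvd (hp _) (dvd_iff_isRoot.2 hμ)).symm
  have hvec : ∀ c, Associated (p (g c)) (X - Polynomial.C μ) →
      ∃ v : ℂ[X] ⧸ I c, v ≠ 0 ∧ C (ψ (Pi.single c v)) = μ • ψ (Pi.single c v) := by
    intro c hc
    refine ⟨Ideal.Quotient.mk _ (p (g c) ^ (e (g c) - 1)), ?_, ?_⟩
    · rw [Ne, Ideal.Quotient.eq_zero_iff_mem, hI, Ideal.mem_span_singleton,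
        pow_dvd_pow_iff (hp _).ne_zero (hp _).not_isUnit]
      omega
    · rw [← hψX, ← map_smul, ← sub_eq_zero, ← map_sub, ← Pi.single_smul, ← Pi.single_smul,
        ← Pi.single_sub]
      have h0 : (X : ℂ[X]) • (Ideal.Quotient.mk (I c) (p (g c) ^ (e (g c) - 1))) -
          μ • (Ideal.Quotient.mk (I c) (p (g c) ^ (e (g c) - 1))) = 0 := by
        have h1 : (X : ℂ[X]) • (Ideal.Quotient.mk (I c) (p (g c) ^ (e (g c) - 1))) -
          μ • (Ideal.Quotient.mk (I c) (p (g c) ^ (e (g c) - 1))) =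
            Ideal.Quotient.mk (I c) ((X - Polynomial.C μ) * p (g c) ^ (e (g c) - 1)) := by
          rw [sub_mul, map_sub, ← Polynomial.smul_eq_C_mul]
          rfl
        rw [h1, Ideal.Quotient.eq_zero_iff_mem, hI, Ideal.mem_span_singleton, pow_succ']
        exact mul_dvd_mul_right hc.dvd _
      rw [h0, Pi.single_zero, map_zero]
  obtain ⟨v, hv0, hv⟩ := hvec b hassX
  obtain ⟨v', hv'0, hv'⟩ := hvec b' (hass.symm.trans hassX)
  obtain ⟨w, hw⟩ := finrank_le_one_iff.1 (hC μ)
  obtain ⟨c, hc⟩ := hw ⟨_, Module.End.mem_eigenspace_iff.2 hv⟩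
  obtain ⟨c', hc'⟩ := hw ⟨_, Module.End.mem_eigenspace_iff.2 hv'⟩
  have hc1 : c • (w : V) = ψ (Pi.single b v) := congrArg Subtype.val hc
  have hc2 : c' • (w : V) = ψ (Pi.single b' v') := congrArg Subtype.val hc'
  have h3 : c' • Pi.single (M := fun b => ℂ[X] ⧸ I b) b v = c • Pi.single b' v' := by
    apply ψ.injective
    rw [map_smul, map_smul, ← hc1, ← hc2, smul_comm]
  have h4 := congrFun h3 b
  rw [Pi.smul_apply, Pi.smul_apply, Pi.single_eq_same, Pi.single_eq_of_ne hbb', smul_zero] at h4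
  have h5 : c' = 0 := (smul_eq_zero.1 h4).resolve_right hv0
  rw [h5, zero_smul, eq_comm, map_eq_zero_iff _ ψ.injective] at hc2
  exact hv'0 (by simpa using congrFun hc2 b')

end CyclicDecomposition

section Classification

variable {n : ℕ} {A : Type} [CommRing A] [Algebra ℂ A] {ι : Type} [Fintype ι] [DecidableEq ι]

/-- The multilinear form with coefficients given by a state. -/
def toForm (Ψ : QState n ι) : MultilinearMap ℂ (fun _ : Fin n => ι → ℂ) ℂ :=
  ∑ x, Ψ x • (MultilinearMap.mkPiAlgebra ℂ (Fin n) ℂ).compLinearMap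
    fun i => LinearMap.proj (x i)

lemma toForm_apply (Ψ : QState n ι) (v : Fin n → ι → ℂ) :
    toForm Ψ v = ∑ x, (∏ i, v i (x i)) * Ψ x := by
  simp [toForm, mul_comm]

lemma toForm_rows (Ψ : QState n ι) (S : Fin n → Matrix ι ι ℂ) (y : Fin n → ι) :
    toForm Ψ (fun i => S i (y i)) = localOp S Ψ y := toForm_apply _ _

lemma toForm_single (Ψ : QState n ι) (y : Fin n → ι) :
    toForm Ψ (fun i => Pi.single (y i) 1) = Ψ y := by
  have := toForm_rows Ψ (fun _ => 1) y
  rw [localOp_one] at this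
  rw [← this]
  congr 1
  ext i a
  simp [Matrix.one_apply, Pi.single_apply, eq_comm]

/-- A multilinear form on a commutative algebra for which factors can be moved between the
arguments depends on the product of the arguments only. -/
lemma multilinear_eq_of_move (F : MultilinearMap ℂ (fun _ : Fin n => A) ℂ) (i : Fin n)
    (h : ∀ j, j ≠ i → ∀ (z : A) (a : Fin n → A),
      F (Function.update a i (z * a i)) = F (Function.update a j (z * a j))) (a : Fin n → A) :
    F a = F (Function.update 1 i (∏ j, a j)) := by
  have key : ∀ s : Finset (Fin n), i ∉ s →
      F a = F (Function.update (s.piecewise 1 a) i (a i * ∏ j ∈ s, a j)) := by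
    intro s
    induction s using Finset.induction_on with
    | empty => simp
    | insert j s hj ih =>
      intro hi
      simp only [Finset.mem_insert, not_or] at hi
      rw [ih hi.2]
      have hji : j ≠ i := Ne.symm hi.1
      have h1 := h j hji (a j) (Function.update (Function.update (s.piecewise 1 a) i
        (a i * ∏ j ∈ s, a j)) j 1)
      rw [Function.update_self, mul_one, Function.update_idem, Function.update_of_ne hji.symm,
        Function.update_self] at h1
      have e1 : Function.update (Function.update (s.piecewise 1 a) i (a i * ∏ j ∈ s, a j)) j (a j)
          = Function.update (s.piecewise 1 a) i (a i * ∏ j ∈ s, a j) := by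
        rw [Function.update_eq_self_iff, Function.update_of_ne hji,
          Finset.piecewise_eq_of_notMem _ _ _ hj]
      have e2 : Function.update (Function.update (Function.update (s.piecewise 1 a) i
          (a i * ∏ j ∈ s, a j)) j 1) i (a j * (a i * ∏ j ∈ s, a j)) =
          Function.update ((insert j s).piecewise 1 a) i (a i * ∏ j ∈ insert j s, a j) := by
        rw [Function.update_comm hji, Function.update_idem,
          Function.update_comm hji.symm, Finset.piecewise_insert, Finset.prod_insert hj,
          mul_left_comm]
        rfl
      rw [← e2, h1, e1]
  rw [key (Finset.univ.erase i) (by simp), Finset.mul_prod_erase _ _ (Finset.mem_univ i)]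
  congr 1
  ext1 j
  by_cases hj : j = i
  · subst hj; simp
  · simp [hj]

lemma nondegenerate_of_fullyEntangled [NeZero n] {φ : A →ₗ[ℂ] ℂ} {β : Module.Basis ι ℂ A}
    (h : FullyEntangled (formState φ fun _ : Fin n => β)) (a : A)
    (ha : ∀ b, φ (a * b) = 0) : a = 0 := by
  rw [← β.repr.map_eq_zero_iff]
  refine Finsupp.ext fun c => congrFun ((fullyEntangled_iff _).1 h 0 (β.repr a) fun x => ?_) c
  have key : ∀ c, ∏ o, β (Function.update x 0 c o) =
      β c * ∏ o ∈ Finset.univ.erase 0, β (x o) := by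
    intro c
    rw [← Finset.mul_prod_erase _ _ (Finset.mem_univ 0), Function.update_self]
    congr 1
    exact Finset.prod_congr rfl fun o ho => by
      rw [Function.update_of_ne (Finset.ne_of_mem_erase ho)]
  simp only [formState, key]
  rw [← ha (∏ o ∈ Finset.univ.erase 0, β (x o))]
  conv_rhs => rw [← β.sum_repr a, Finset.sum_mul, map_sum]
  exact Finset.sum_congr rfl fun c _ => by rw [smul_mul_assoc, map_smul, smul_eq_mul]

/-- States defined by two nondegenerate forms on the same algebra are SLOCC equivalent. -/
lemma sloccEquivalent_formState_formState [NeZero n] [FiniteDimensional ℂ A] {φ φ₀ : A →ₗ[ℂ] ℂ}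
    (hφ : ∀ a, (∀ b, φ (a * b) = 0) → a = 0) (hφ₀ : ∀ a, (∀ b, φ₀ (a * b) = 0) → a = 0)
    {κ : Type} [Fintype κ] [DecidableEq κ] (β : Module.Basis ι ℂ A) (E : Module.Basis κ ℂ A) :
    SLOCCEquivalent (formState φ fun _ : Fin n => β) (formState φ₀ fun _ : Fin n => E) := by
  let D : A →ₗ[ℂ] Module.Dual ℂ A := (LinearMap.mul ℂ A).compr₂ φ₀
  have hD : Function.Injective D := by
    rw [← LinearMap.ker_eq_bot, LinearMap.ker_eq_bot']
    intro a ha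
    exact hφ₀ a fun b => LinearMap.congr_fun ha b
  have hDs : Function.Surjective D :=
    (LinearMap.injective_iff_surjective_of_finrank_eq_finrank
      (Subspace.dual_finrank_eq (K := ℂ) (V := A)).symm).1 hD
  obtain ⟨w, hw⟩ := hDs φ
  have hwφ : ∀ a, φ a = φ₀ (w * a) := fun a => (LinearMap.congr_fun hw a).symm
  have hwi : Function.Injective (LinearMap.mulLeft ℂ w) := by
    rw [← LinearMap.ker_eq_bot, LinearMap.ker_eq_bot']
    intro a ha
    refine hφ a fun b => ?_
    rw [LinearMap.mulLeft_apply] at ha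
    rw [hwφ, ← mul_assoc, ha, zero_mul, map_zero]
  let β' : Module.Basis ι ℂ A := β.map (LinearEquiv.ofInjectiveEndo _ hwi)
  have : (formState φ fun _ : Fin n => β) =
      formState φ₀ fun i => (Function.update (fun _ => β) 0 β' : Fin n → Module.Basis ι ℂ A) i := by
    ext x
    simp only [formState, hwφ]
    congr 1
    rw [← Finset.mul_prod_erase _ _ (Finset.mem_univ 0),
      ← Finset.mul_prod_erase (a := (0 : Fin n)) _
        (fun i => Function.update (fun _ => β) 0 β' i (x i)) (Finset.mem_univ 0), ← mul_assoc,
      Function.update_self]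
    congr 1
    exact Finset.prod_congr rfl fun o ho => by
      rw [Function.update_of_ne (Finset.ne_of_mem_erase ho)]
  rw [this]
  exact sloccEquivalent_formState φ₀ _ fun _ => E

lemma IsSymmetric.localOp_comp_swap {Φ : QState n ι} (hΦ : IsSymmetric Φ)
    (S : Fin n → Matrix ι ι ℂ) (i j : Fin n) (y : Fin n → ι) :
    localOp (S ∘ Equiv.swap i j) Φ (y ∘ Equiv.swap i j) = localOp S Φ y := by
  simp only [localOp, Function.comp_apply]
  rw [← Equiv.sum_comp (Equiv.arrowCongr (Equiv.swap i j) (Equiv.refl ι))]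
  refine Finset.sum_congr rfl fun x _ => ?_
  have h1 : (Equiv.arrowCongr (Equiv.swap i j) (Equiv.refl ι)) x = x ∘ Equiv.swap i j := by
    ext o
    simp [Equiv.arrowCongr]
  rw [h1, hΦ]
  congr 1
  exact Equiv.prod_comp (Equiv.swap i j) fun o => S o (y o) (x o)

/-- Fully entangled symmetric states that are stabilised by `B ⊗ B⁻¹` with non-derogatory `B`
are SLOCC equivalent to direct sums of excitation states. -/
theorem exists_sloccEquivalent_blockState [NeZero n] {Φ : QState n ι} (hΦ : FullyEntangled Φ)
    (hsymm : IsSymmetric Φ) {B : Matrix ι ι ℂ} (hB : IsUnit B) (hnd : IsNonderogatory B)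
    {i j : Fin n} (hij : i ≠ j)
    (hstab : localOp (Function.update (Function.update (fun _ => (1 : Matrix ι ι ℂ)) i B) j B⁻¹) Φ
      = Φ) : ∃ (K : ℕ) (k : Fin K → ℕ), SLOCCEquivalent Φ (blockState n k) := by
  have hB' := (Matrix.isUnit_iff_isUnit_det _).1 hB
  have hmove₀ : actAt i B Φ = actAt j B Φ := by
    conv_rhs => rw [← hstab]
    rw [actAt, actAt, localOp_localOp]
    congr 1
    ext1 o
    by_cases ho : o = j
    · subst ho
      simp [hij.symm, Matrix.mul_nonsing_inv _ hB']
    · simp [ho]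
  have hmove : ∀ l, l ≠ i → actAt i B Φ = actAt l B Φ := by
    intro l hl
    ext y
    have h1 := hsymm.localOp_comp_swap (Function.update (fun _ => 1) i B) j l y
    have h2 := hsymm.localOp_comp_swap (Function.update (fun _ => 1) l B) j l y
    have e1 : Function.update (fun _ => (1 : Matrix ι ι ℂ)) i B ∘ Equiv.swap j l =
        Function.update (fun _ => 1) i B := by
      rw [Function.update_comp_equiv, Equiv.symm_swap, Equiv.swap_apply_of_ne_of_ne hij hl.symm]
      rfl
    have e2 : Function.update (fun _ => (1 : Matrix ι ι ℂ)) l B ∘ Equiv.swap j l =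
        Function.update (fun _ => 1) j B := by
      rw [Function.update_comp_equiv, Equiv.symm_swap, Equiv.swap_apply_right]
      rfl
    rw [e1] at h1
    rw [e2] at h2
    rw [actAt, actAt, ← h1, ← h2]
    exact congrFun hmove₀ _
  let C : (ι → ℂ) →ₗ[ℂ] (ι → ℂ) := Matrix.toLin' Bᵀ
  have hC : ∀ μ : ℂ, Module.finrank ℂ (Module.End.eigenspace C μ) ≤ 1 := by
    intro μ
    have hrk : ∀ N : Matrix ι ι ℂ, Module.finrank ℂ (Module.End.eigenspace (Matrix.toLin' N) μ) +
        (N - μ • 1).rank = Fintype.card ι := by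
      intro N
      have h1 := LinearMap.finrank_range_add_finrank_ker (Matrix.toLin' (N - μ • 1))
      rw [Module.finrank_fintype_fun_eq_card] at h1
      have h2 : Matrix.toLin' (N - μ • 1) = Matrix.toLin' N - μ • 1 := by
        rw [map_sub, map_smul, Matrix.toLin'_one]
        rfl
      rw [Module.End.eigenspace_def, ← h2, ← h1, add_comm]
      rfl
    have h1 := hrk Bᵀ
    have h2 := hrk B
    have h3 : (Bᵀ - μ • 1).rank = (B - μ • 1).rank := by
      rw [← Matrix.rank_transpose (B - μ • 1), Matrix.transpose_sub, Matrix.transpose_smul,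
        Matrix.transpose_one]
    have h4 := hnd μ
    simp only [C]
    omega
  have hFC : ∀ l, l ≠ i → ∀ v : Fin n → ι → ℂ, toForm Φ (Function.update v i (C (v i))) =
      toForm Φ (Function.update v l (C (v l))) := by
    intro l hl v
    have hrow : ∀ (o : Fin n) (v : Fin n → ι → ℂ), Function.update v o (C (v o)) =
        fun o' => (Function.update (fun _ => LinearMap.id) o C : Fin n → (ι → ℂ) →ₗ[ℂ] (ι → ℂ)) o'
          (v o') := by
      intro o v
      ext1 o'
      by_cases h : o' = o
      · subst h; simp
      · simp [h]
    have : (toForm Φ).compLinearMap (Function.update (fun _ => LinearMap.id) i C) =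
        (toForm Φ).compLinearMap (Function.update (fun _ => LinearMap.id) l C) := by
      refine Module.Basis.ext_multilinear (fun _ => Pi.basisFun ℂ ι) fun y => ?_
      simp only [MultilinearMap.compLinearMap_apply]
      have hr : ∀ o : Fin n, (fun o' => (Function.update (fun _ => LinearMap.id) o C :
          Fin n → (ι → ℂ) →ₗ[ℂ] (ι → ℂ)) o' (Pi.basisFun ℂ ι (y o'))) =
          fun o' => Function.update (fun _ => (1 : Matrix ι ι ℂ)) o B o' (y o') := by
        intro o
        ext o' a
        by_cases h : o' = o
        · subst h
          simp [C, Matrix.toLin'_apply]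
        · simp [h, Matrix.one_apply, Pi.single_apply, eq_comm]
      rw [hr, hr, toForm_rows, toForm_rows]
      exact congrFun (hmove l hl) y
    have h2 := congrArg (fun F => F v) this
    simp only [MultilinearMap.compLinearMap_apply] at h2
    rw [hrow, hrow]
    exact h2
  obtain ⟨K, k, p, I, hp, hI, hcop, ψ, hψ⟩ := exists_cyclic_decomposition C hC
  let P : ∀ b, NilpotentPowerBasis (Polynomial ℂ ⧸ I b) (k b) := fun b =>
    (exists_nilpotentPowerBasis_of_eq (hp b) (hI b)).some
  refine ⟨K, k, ?_⟩
  let F : MultilinearMap ℂ (fun _ : Fin n => ∀ b, Polynomial ℂ ⧸ I b) ℂ :=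
    (toForm Φ).compLinearMap fun _ => ψ.toLinearMap
  have hFapply : ∀ a, F a = toForm Φ fun o => ψ (a o) := fun a => rfl
  let ρ : Polynomial ℂ →+* (∀ b, Polynomial ℂ ⧸ I b) := RingHom.pi fun b => Ideal.Quotient.mk (I b)
  have hψρ : ∀ a, ψ (ρ Polynomial.X * a) = C (ψ a) := by
    intro a
    rw [← hψ]
    congr 1
  have hρC : ∀ (c : ℂ) z, ρ (Polynomial.C c) * z = c • z := by
    intro c z
    ext b
    obtain ⟨r, hr⟩ := Ideal.Quotient.mk_surjective (z b)
    change Ideal.Quotient.mk (I b) (Polynomial.C c) * z b = c • z b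
    rw [← hr, ← map_mul, ← Polynomial.smul_eq_C_mul]
    rfl
  have hFq : ∀ l, l ≠ i → ∀ (q : Polynomial ℂ) (a : Fin n → ∀ b, Polynomial ℂ ⧸ I b),
      F (Function.update a i (ρ q * a i)) = F (Function.update a l (ρ q * a l)) := by
    intro l hl q
    have hX : ∀ a : Fin n → ∀ b, Polynomial ℂ ⧸ I b,
        F (Function.update a i (ρ Polynomial.X * a i)) =
          F (Function.update a l (ρ Polynomial.X * a l)) := by
      intro a
      have hup : ∀ (o : Fin n) z, (fun o' => ψ (Function.update a o z o')) =
          Function.update (fun o' => ψ (a o')) o (ψ z) := by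
        intro o z
        ext1 o'
        by_cases h : o' = o
        · subst h; simp
        · simp [h]
      rw [hFapply, hFapply, hup, hup, hψρ, hψρ]
      exact hFC l hl fun o => ψ (a o)
    induction q using Polynomial.induction_on with
    | C c =>
      intro a
      rw [hρC, hρC, MultilinearMap.map_update_smul, MultilinearMap.map_update_smul,
        Function.update_eq_self, Function.update_eq_self]
    | add q q' h h' =>
      intro a
      rw [map_add, add_mul, add_mul, MultilinearMap.map_update_add,
        MultilinearMap.map_update_add, h, h']
    | monomial m c ih =>
      intro a
      rw [pow_succ, ← mul_assoc]
      generalize Polynomial.C c * Polynomial.X ^ m = q at ih ⊢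
      rw [map_mul, mul_assoc, mul_comm (ρ q) (ρ Polynomial.X), mul_assoc]
      have h1 := ih (Function.update a i (ρ Polynomial.X * a i))
      rw [Function.update_self, Function.update_idem, Function.update_of_ne hl] at h1
      have h2 := hX (Function.update a l (ρ q * a l))
      rw [Function.update_self, Function.update_idem, Function.update_of_ne hl.symm,
        Function.update_comm hl] at h2
      rw [h1, h2]
  have hFmul := multilinear_eq_of_move F i fun l hl z a => by
    obtain ⟨q, hq⟩ := Ideal.pi_quotient_surjective hcop z
    have hz : z = ρ q := funext fun b => (hq b).symm
    rw [hz]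
    exact hFq l hl q a
  let φ : (∀ b, Polynomial ℂ ⧸ I b) →ₗ[ℂ] ℂ := F.toLinearMap 1 i
  let β : Module.Basis ι ℂ (∀ b, Polynomial ℂ ⧸ I b) := (Pi.basisFun ℂ ι).map ψ.symm
  have hΦφ : Φ = formState φ fun _ => β := by
    ext y
    rw [formState]
    change _ = F (Function.update 1 i (∏ o, β (y o)))
    rw [← hFmul fun o => β (y o), hFapply, ← toForm_single Φ y]
    congr 1
    ext1 o
    simp [β]
  have : FiniteDimensional ℂ (∀ b, Polynomial ℂ ⧸ I b) := β.finiteDimensional_of_finite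
  rw [hΦφ] at hΦ ⊢
  rw [blockState_eq_formState P]
  exact sloccEquivalent_formState_formState (nondegenerate_of_fullyEntangled hΦ)
    (blockForm_nondegenerate P) β (blockBasis P)

end Classification

section QubitClasses

variable {n : ℕ}

lemma blockState_apply {K : ℕ} (k : Fin K → ℕ) (x : Fin n → Σ b, Fin (k b + 1)) :
    blockState n k x =
      ∑ b, if (∀ i, (x i).1 = b) ∧ ∑ i, ((x i).2 : ℕ) = k b then 1 else 0 := by
  rw [blockState, directSum, Finset.sum_apply]
  refine Finset.sum_congr rfl fun c _ => ?_
  simp only [Finset.sum_apply, Pi.smul_apply, smul_eq_mul, excitationState, Pi.single_apply]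
  by_cases hx : ∀ i, (x i).1 = c
  · obtain ⟨y, rfl⟩ : ∃ y : Fin n → Fin (k c + 1), x = fun i => ⟨c, y i⟩ := by
      have : ∀ i, ∃ l : Fin (k c + 1), x i = ⟨c, l⟩ := by
        intro i
        have := hx i
        generalize x i = z at this ⊢
        obtain ⟨b, l⟩ := z
        subst this
        exact ⟨l, rfl⟩
      choose y hy using this
      exact ⟨y, funext hy⟩
    rw [Finset.sum_eq_single y]
    · simp
    · intro y' _ hy'
      have hne : (fun i => (⟨c, y i⟩ : Σ b, Fin (k b + 1))) ≠ fun i => ⟨c, y' i⟩ := by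
        intro h
        apply hy'
        ext1 i
        have := congrFun h i
        simpa using this.symm
      rw [if_neg hne, mul_zero]
    · simp
  · rw [if_neg (fun h => hx h.1)]
    refine Finset.sum_eq_zero fun y _ => ?_
    have hne : x ≠ fun i => ⟨c, y i⟩ := by
      rintro rfl
      exact hx fun _ => rfl
    rw [if_neg hne, mul_zero]

open Polynomial in
lemma of_eq_blockState_comp (hn : 3 ≤ n) {K : ℕ} (k : Fin K → ℕ) {κ : Type} [Fintype κ]
    [DecidableEq κ] (e : (Σ b, Fin (k b + 1)) ≃ κ) {Ψ : QState n κ}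
    (h : ∀ y, Ψ y = blockState n k (e.symm ∘ y)) :
    FullyEntangled Ψ ∧ IsSymmetric Ψ ∧ SLOCCEquivalent Ψ (blockState n k) := by
  have : NeZero n := ⟨by omega⟩
  choose P _ using fun b => exists_nilpotentPowerBasis_quotient (irreducible_X (R := ℂ)) (k b)
  have hΨ : Ψ = formState (blockForm P) fun _ => (blockBasis P).reindex e := by
    ext y
    rw [h, blockState_eq_formState P]
    simp [formState]
  rw [hΨ]
  refine ⟨fullyEntangled_formState hn (blockForm_nondegenerate P) fun _ => (blockBasis P).reindex e,
    isSymmetric_formState _ _, ?_⟩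
  rw [blockState_eq_formState P]
  exact sloccEquivalent_formState _ (fun _ => (blockBasis P).reindex e) fun _ => blockBasis P

lemma qubitW_apply (y : Fin n → Fin 2) :
    qubitW n y = if ∑ i, (y i : ℕ) = 1 then 1 else 0 := by
  simp only [qubitW, Finset.sum_apply, Pi.single_apply]
  split_ifs with h
  · obtain ⟨i, -, hi⟩ : ∃ i ∈ Finset.univ, (y i : ℕ) ≠ 0 :=
      Finset.exists_ne_zero_of_sum_ne_zero (by rw [h]; exact one_ne_zero)
    have hrest : ∀ j, j ≠ i → (y j : ℕ) = 0 := by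
      have h1 := Finset.add_sum_erase Finset.univ (fun i => (y i : ℕ)) (Finset.mem_univ i)
      have h2 : ∑ j ∈ Finset.univ.erase i, (y j : ℕ) = 0 := by omega
      intro j hj
      exact Finset.sum_eq_zero_iff.1 h2 j (by simp [hj])
    have hy : y = Pi.single i 1 := by
      ext j
      by_cases hj : j = i
      · subst hj
        have := (y j).2
        rw [Pi.single_eq_same]
        simp only [Fin.val_one]
        omega
      · rw [hrest j hj, Pi.single_eq_of_ne hj]
        rfl
    rw [Finset.sum_eq_single i]
    · rw [if_pos hy]
    · intro j _ hj
      rw [if_neg]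
      intro h'
      have := congrFun h' i
      rw [Pi.single_eq_of_ne hj.symm] at this
      exact hi (by rw [this]; rfl)
    · simp
  · refine Finset.sum_eq_zero fun i _ => ?_
    rw [if_neg]
    rintro rfl
    apply h
    rw [Finset.sum_eq_single i]
    · simp
    · intro j _ hj
      rw [Pi.single_eq_of_ne hj]
      rfl
    · simp

lemma qubitGHZ_apply (y : Fin n → Fin 2) :
    qubitGHZ n y = (if ∀ i, y i = 0 then 1 else 0) + if ∀ i, y i = 1 then 1 else 0 := by
  simp only [qubitGHZ, Pi.add_apply, Pi.single_apply, funext_iff]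

lemma qubitW_properties (hn : 3 ≤ n) : FullyEntangled (qubitW n) ∧ IsSymmetric (qubitW n) ∧
    SLOCCEquivalent (qubitW n) (blockState n fun _ : Fin 1 => 1) := by
  refine of_eq_blockState_comp hn (fun _ : Fin 1 => 1)
    (Equiv.uniqueSigma fun _ : Fin 1 => Fin 2) fun y => ?_
  rw [qubitW_apply, blockState_apply, Fin.sum_univ_one]
  simp

lemma qubitGHZ_properties (hn : 3 ≤ n) : FullyEntangled (qubitGHZ n) ∧ IsSymmetric (qubitGHZ n) ∧
    SLOCCEquivalent (qubitGHZ n) (blockState n fun _ : Fin 2 => 0) := by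
  let e : (Σ _ : Fin 2, Fin (0 + 1)) ≃ Fin 2 :=
    { toFun := fun x => x.1
      invFun := fun a => ⟨a, 0⟩
      left_inv := fun x => sigma_fin_ext (k := fun _ : Fin 2 => 0) rfl (by have := x.2.2; simp)
      right_inv := fun _ => rfl }
  refine of_eq_blockState_comp hn (fun _ : Fin 2 => 0) e fun y => ?_
  rw [qubitGHZ_apply, blockState_apply, Fin.sum_univ_two]
  simp [e]

lemma localOp_single (A : Fin n → Matrix (Fin 2) (Fin 2) ℂ) (x : Fin n → Fin 2) :
    localOp A (Pi.single x 1) = fun y => ∏ i, A i (y i) (x i) := by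
  ext y
  rw [localOp, Finset.sum_eq_single x]
  · simp
  · intro z _ hz
    rw [Pi.single_eq_of_ne hz, mul_zero]
  · simp

lemma localOp_add {ι : Type} [Fintype ι] (A : Fin n → Matrix ι ι ℂ) (Ψ Φ : QState n ι) :
    localOp A (Ψ + Φ) = localOp A Ψ + localOp A Φ := by
  ext y
  simp [localOp, mul_add, Finset.sum_add_distrib]

lemma localOp_sum {ι τ : Type} [Fintype ι] (A : Fin n → Matrix ι ι ℂ) (s : Finset τ)
    (Ψ : τ → QState n ι) : localOp A (∑ t ∈ s, Ψ t) = ∑ t ∈ s, localOp A (Ψ t) := by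
  ext y
  simp only [localOp, Finset.sum_apply, Finset.mul_sum]
  exact Finset.sum_comm

lemma prod_ite_eq_const (a : Fin n → ℂ) (c : Fin 2) (y : Fin n → Fin 2) :
    ∏ i, (if y i = c then a i else 0) =
      (∏ i, a i) * (Pi.single (fun _ => c) 1 : QState n (Fin 2)) y := by
  rw [Pi.single_apply]
  split_ifs with h
  · subst h
    simp
  · rw [mul_zero]
    obtain ⟨i, hi⟩ := Function.ne_iff.1 h
    exact Finset.prod_eq_zero (Finset.mem_univ i) (if_neg hi)

lemma localOp_antidiagonal_qubitGHZ (a b : Fin n → ℂ) (ha : ∏ i, a i = 1) (hb : ∏ i, b i = 1) :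
    localOp (fun i => !![0, a i; b i, 0]) (qubitGHZ n) = qubitGHZ n := by
  rw [qubitGHZ, localOp_add, localOp_single, localOp_single, add_comm]
  congr 1
  · ext y
    have h := prod_ite_eq_const a 0 y
    rw [ha, one_mul] at h
    rw [← h]
    refine Finset.prod_congr rfl fun i _ => ?_
    generalize y i = z
    fin_cases z <;> simp
  · ext y
    have h := prod_ite_eq_const b 1 y
    rw [hb, one_mul] at h
    rw [← h]
    refine Finset.prod_congr rfl fun i _ => ?_
    generalize y i = z
    fin_cases z <;> simp

lemma localOp_diagonal_qubitGHZ (a b : Fin n → ℂ) :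
    localOp (fun i => !![a i, 0; 0, b i]) (qubitGHZ n) =
      (∏ i, a i) • Pi.single (fun _ => 0) 1 + (∏ i, b i) • Pi.single (fun _ => 1) 1 := by
  rw [qubitGHZ, localOp_add, localOp_single, localOp_single]
  congr 1
  · ext y
    rw [Pi.smul_apply, smul_eq_mul, ← prod_ite_eq_const]
    refine Finset.prod_congr rfl fun i _ => ?_
    generalize y i = z
    fin_cases z <;> simp
  · ext y
    rw [Pi.smul_apply, smul_eq_mul, ← prod_ite_eq_const]
    refine Finset.prod_congr rfl fun i _ => ?_
    generalize y i = z
    fin_cases z <;> simp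

lemma localOp_triangular_qubitW (t : Fin n → ℂ) (m : ℂ) :
    localOp (fun i => !![1, t i; 0, m]) (qubitW n) =
      m • qubitW n + (∑ i, t i) • Pi.single 0 1 := by
  rw [qubitW, localOp_sum, Finset.smul_sum, Finset.sum_smul, ← Finset.sum_add_distrib]
  refine Finset.sum_congr rfl fun i _ => ?_
  rw [localOp_single]
  ext y
  rw [Pi.add_apply, Pi.smul_apply, Pi.smul_apply, smul_eq_mul, smul_eq_mul,
    ← Finset.mul_prod_erase _ _ (Finset.mem_univ i), Pi.single_eq_same]
  have h1 : ∏ j ∈ Finset.univ.erase i,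
      (!![1, t j; 0, m] : Matrix (Fin 2) (Fin 2) ℂ) (y j) ((Pi.single i 1 : Fin n → Fin 2) j) =
      if ∀ j, j ≠ i → y j = 0 then 1 else 0 := by
    split_ifs with h
    · refine Finset.prod_eq_one fun j hj => ?_
      have hj' := Finset.ne_of_mem_erase hj
      rw [Pi.single_eq_of_ne hj', h j hj']
      simp
    · push Not at h
      obtain ⟨j, hj, hyj⟩ := h
      refine Finset.prod_eq_zero (i := j) (by simp [hj]) ?_
      rw [Pi.single_eq_of_ne hj, Fin.eq_one_of_ne_zero _ hyj]
      simp
  rw [h1, Pi.single_apply, Pi.single_apply]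
  by_cases h : ∀ j, j ≠ i → y j = 0
  · have hy : y = Pi.single i (y i) := by
      ext1 j
      by_cases hj : j = i
      · subst hj; simp
      · rw [h j hj, Pi.single_eq_of_ne hj]
    rw [if_pos h, mul_one]
    by_cases hyi : y i = 0
    · have hy0 : y = 0 := by rw [hy, hyi, Pi.single_zero]
      have hne : y ≠ Pi.single i 1 := by
        intro h'
        have := congrFun h' i
        rw [hyi, Pi.single_eq_same] at this
        exact zero_ne_one this
      rw [if_neg hne, if_pos hy0, hyi]
      simp
    · have hyi1 := Fin.eq_one_of_ne_zero _ hyi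
      have hy0 : y ≠ 0 := by
        intro h'
        exact hyi (congrFun h' i)
      rw [hyi1] at hy
      rw [if_pos hy, if_neg hy0, hyi1]
      simp
  · have hy0 : y ≠ 0 := by
      rintro rfl
      exact h fun _ _ => rfl
    have hne : y ≠ Pi.single i 1 := by
      rintro rfl
      exact h fun j hj => Pi.single_eq_of_ne hj _
    rw [if_neg h, if_neg hy0, if_neg hne]
    simp

/-- The Gram entries of the columns of an invertible `2 × 2` matrix. -/
lemma exists_gram_entries {g : Matrix (Fin 2) (Fin 2) ℂ} (hg : IsUnit g) :
    ∃ (a c : ℝ) (b : ℂ), 0 < a ∧ 0 < c ∧ gᴴ * g = !![(a : ℂ), b; star b, (c : ℂ)] := by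
  have hpd : (gᴴ * g).PosDef := by
    refine Matrix.PosDef.conjTranspose_mul_self _ ?_
    exact Matrix.mulVec_injective_iff_isUnit.2 hg
  have h0 := hpd.diag_pos (i := 0)
  have h1 := hpd.diag_pos (i := 1)
  have hherm := hpd.isHermitian.apply 1 0
  rw [Complex.pos_iff] at h0 h1
  refine ⟨((gᴴ * g) 0 0).re, ((gᴴ * g) 1 1).re, (gᴴ * g) 0 1, h0.1, h1.1, ?_⟩
  ext i j
  fin_cases i <;> fin_cases j
  · exact Complex.ext rfl h0.2.symm
  · rfl
  · exact hherm.symm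
  · exact Complex.ext rfl h1.2.symm

lemma conj_mem_unitaryGroup {ι : Type} [Fintype ι] [DecidableEq ι] {g s : Matrix ι ι ℂ}
    (hg : IsUnit g) (h : sᴴ * (gᴴ * g) * s = gᴴ * g) :
    g * s * g⁻¹ ∈ Matrix.unitaryGroup ι ℂ := by
  have hg' := (Matrix.isUnit_iff_isUnit_det _).1 hg
  rw [Matrix.mem_unitaryGroup_iff', Matrix.star_eq_conjTranspose]
  calc (g * s * g⁻¹)ᴴ * (g * s * g⁻¹) = (g⁻¹)ᴴ * (sᴴ * (gᴴ * g) * s) * g⁻¹ := by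
        simp only [Matrix.conjTranspose_mul, Matrix.mul_assoc]
    _ = (g * g⁻¹)ᴴ * (g * g⁻¹) := by
        rw [h]
        simp only [Matrix.conjTranspose_mul, Matrix.mul_assoc]
    _ = 1 := by rw [Matrix.mul_nonsing_inv _ hg']; simp

lemma exists_triangular_unitary {g : Matrix (Fin 2) (Fin 2) ℂ} (hg : IsUnit g) :
    ∃ t : ℂ, g * !![1, t; 0, -1] * g⁻¹ ∈ Matrix.unitaryGroup (Fin 2) ℂ := by
  obtain ⟨a, c, b, ha, hc, hG⟩ := exists_gram_entries hg
  have ha' : (a : ℂ) ≠ 0 := by exact_mod_cast ha.ne'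
  refine ⟨2 * b / a, conj_mem_unitaryGroup hg ?_⟩
  rw [hG]
  ext i j
  fin_cases i <;> fin_cases j <;>
    simp [Matrix.mul_apply, Fin.sum_univ_two, Matrix.conjTranspose_apply, Complex.conj_ofNat] <;>
    field_simp <;> ring

lemma exists_antidiagonal_unitary {g : Matrix (Fin 2) (Fin 2) ℂ} (hg : IsUnit g) :
    ∃ x y : ℂ, x ≠ 0 ∧ y ≠ 0 ∧ g * !![0, x; y, 0] * g⁻¹ ∈ Matrix.unitaryGroup (Fin 2) ℂ := by
  obtain ⟨a, c, b, ha, hc, hG⟩ := exists_gram_entries hg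
  obtain ⟨ω, hω, hωb⟩ : ∃ ω : ℂ, ω * star ω = 1 ∧ ω * star b = b := by
    by_cases hb : b = 0
    · exact ⟨1, by simp, by simp [hb]⟩
    · have hb' : star b ≠ 0 := star_ne_zero.2 hb
      refine ⟨b / star b, ?_, div_mul_cancel₀ _ hb'⟩
      rw [star_div₀, star_star, div_mul_div_comm, mul_comm, div_self (mul_ne_zero hb' hb)]
  have hω' : star ω * b = star b := by
    have := congrArg star hωb
    rwa [star_mul', star_star] at this
  set r := Real.sqrt (a / c) with hr
  have hr0 : 0 < r := Real.sqrt_pos.2 (div_pos ha hc)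
  have hrr : r * r = a / c := Real.mul_self_sqrt (div_pos ha hc).le
  have hr0' : (r : ℂ) ≠ 0 := by exact_mod_cast hr0.ne'
  have h1 : (r : ℂ) * r * c = a := by
    have : r * r * c = a := by rw [hrr, div_mul_cancel₀ _ hc.ne']
    exact_mod_cast this
  have hω0 : ω ≠ 0 := left_ne_zero_of_mul_eq_one hω
  simp only [Complex.star_def] at hω hωb hω'
  refine ⟨ω / r, r, div_ne_zero hω0 hr0', hr0', conj_mem_unitaryGroup hg ?_⟩
  rw [hG]
  ext i j
  fin_cases i <;> fin_cases j <;>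
    simp [Matrix.mul_apply, Fin.sum_univ_two, Matrix.conjTranspose_apply]
  · linear_combination h1
  · field_simp
    linear_combination hωb
  · field_simp
    linear_combination hω'
  · field_simp
    rw [← h1]
    linear_combination ((r : ℂ) * r * c) * hω

/-- A symmetry `⨂ sᵢ` of `Ψ` becomes a symmetry of `⨂ gᵢ Ψ` after conjugation. -/
lemma localOp_conj {ι : Type} [Fintype ι] [DecidableEq ι] {g s : Fin n → Matrix ι ι ℂ}
    (hg : ∀ i, IsUnit (g i)) {Ψ : QState n ι} {c : ℂ} (h : localOp s Ψ = c • Ψ) :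
    localOp (fun i => g i * s i * (g i)⁻¹) (localOp g Ψ) = c • localOp g Ψ := by
  rw [← localOp_smul, ← h, localOp_localOp, localOp_localOp]
  congr 1
  ext1 i
  rw [Matrix.mul_assoc, Matrix.nonsing_inv_mul _ ((Matrix.isUnit_iff_isUnit_det _).1 (hg i)),
    Matrix.mul_one]

lemma conj_mul_self {ι : Type} [Fintype ι] [DecidableEq ι] {g s : Matrix ι ι ℂ}
    (hg : IsUnit g) {z : ℂ} (h : s * s = z • 1) :
    g * s * g⁻¹ * (g * s * g⁻¹) = z • 1 := by
  have hg' := (Matrix.isUnit_iff_isUnit_det _).1 hg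
  calc g * s * g⁻¹ * (g * s * g⁻¹) = g * (s * (g⁻¹ * g) * s) * g⁻¹ := by
        simp only [Matrix.mul_assoc]
    _ = z • 1 := by
        rw [Matrix.nonsing_inv_mul _ hg', Matrix.mul_one, h, Matrix.mul_smul, Matrix.smul_mul,
          Matrix.mul_one, Matrix.mul_nonsing_inv _ hg']

lemma conj_ne_smul_one {ι : Type} [Fintype ι] [DecidableEq ι] {g s : Matrix ι ι ℂ}
    (hg : IsUnit g) (h : ∀ w : ℂ, s ≠ w • 1) (w : ℂ) : g * s * g⁻¹ ≠ w • 1 := by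
  have hg' := (Matrix.isUnit_iff_isUnit_det _).1 hg
  intro hw
  refine h w ?_
  calc s = g⁻¹ * (g * s * g⁻¹) * g := by
        simp only [Matrix.mul_assoc, Matrix.nonsing_inv_mul_cancel_left _ _ hg',
          Matrix.nonsing_inv_mul _ hg', Matrix.mul_one]
    _ = w • 1 := by
        rw [hw, Matrix.mul_smul, Matrix.smul_mul, Matrix.mul_one, Matrix.nonsing_inv_mul _ hg']

lemma SLOCCEquivalent.exists_isUnit {ι : Type} [Fintype ι] [DecidableEq ι] {Ψ Φ : QState n ι}
    (h : SLOCCEquivalent Ψ Φ) :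
    ∃ g : Fin n → Matrix ι ι ℂ, (∀ i, IsUnit (g i)) ∧ Ψ = localOp g Φ := by
  obtain ⟨A, A', hA, h⟩ := h
  exact ⟨A, fun i => IsUnit.of_mul_eq_one _ (hA i).1, h⟩

/-- No state in the SLOCC class of the W state is weakly isolated. -/
theorem not_weaklyIsolated_of_qubitW (hn : 3 ≤ n) {Φ : QState n (Fin 2)}
    (h : SLOCCEquivalent Φ (qubitW n)) : ¬ WeaklyIsolated Φ := by
  have : NeZero n := ⟨by omega⟩
  obtain ⟨g, hg, rfl⟩ := h.exists_isUnit
  choose t ht using fun i => exists_triangular_unitary (hg i)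
  set t' := Function.update t 0 (-∑ j ∈ Finset.univ.erase 0, t j) with ht'
  have hsum : ∑ i, t' i = 0 := by
    rw [← Finset.add_sum_erase _ _ (Finset.mem_univ 0), ht', Function.update_self,
      Finset.sum_congr rfl fun j hj => Function.update_of_ne (Finset.ne_of_mem_erase hj) _ _,
      neg_add_cancel]
  have hsym : localOp (fun i => !![1, t' i; 0, -1]) (qubitW n) = (-1 : ℂ) • qubitW n := by
    rw [localOp_triangular_qubitW, hsum, zero_smul, add_zero]
  refine not_weaklyIsolated_of_symmetry (i := 0) (z := 1)
    ((qubitW_properties hn).1.localOp hg) (neg_ne_zero.2 one_ne_zero) (fun j hj => ?_)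
    (localOp_conj hg hsym) (conj_mul_self (hg 0) ?_) (conj_ne_smul_one (hg 0) fun w hw => ?_)
  · rw [ht', Function.update_of_ne hj]
    exact ht j
  · ext a b
    fin_cases a <;> fin_cases b <;> simp [Matrix.mul_apply, Fin.sum_univ_two]
  · have h0 := congrFun (congrFun hw 0) 0
    have h1 := congrFun (congrFun hw 1) 1
    simp at h0 h1
    rw [← h0] at h1
    norm_num at h1

/-- No state in the SLOCC class of the qubit GHZ state is weakly isolated. -/
theorem not_weaklyIsolated_of_qubitGHZ (hn : 3 ≤ n) {Φ : QState n (Fin 2)}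
    (h : SLOCCEquivalent Φ (qubitGHZ n)) : ¬ WeaklyIsolated Φ := by
  have : NeZero n := ⟨by omega⟩
  obtain ⟨g, hg, rfl⟩ := h.exists_isUnit
  choose x y hx hy hxy using fun i => exists_antidiagonal_unitary (hg i)
  have hprod : ∀ x : Fin n → ℂ, (∀ i, x i ≠ 0) →
      ∏ i, Function.update x 0 (∏ j ∈ Finset.univ.erase 0, x j)⁻¹ i = 1 := by
    intro x hx
    rw [← Finset.mul_prod_erase _ _ (Finset.mem_univ 0), Function.update_self,
      Finset.prod_congr rfl fun j hj => Function.update_of_ne (Finset.ne_of_mem_erase hj) _ _]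
    exact inv_mul_cancel₀ (Finset.prod_ne_zero_iff.2 fun j _ => hx j)
  set x' := Function.update x 0 (∏ j ∈ Finset.univ.erase 0, x j)⁻¹ with hx'
  set y' := Function.update y 0 (∏ j ∈ Finset.univ.erase 0, y j)⁻¹ with hy'
  have hsym : localOp (fun i => !![0, x' i; y' i, 0]) (qubitGHZ n) = (1 : ℂ) • qubitGHZ n := by
    rw [localOp_antidiagonal_qubitGHZ _ _ (hprod x hx) (hprod y hy), one_smul]
  have hx0 : x' 0 ≠ 0 := by
    rw [hx', Function.update_self]
    exact inv_ne_zero (Finset.prod_ne_zero_iff.2 fun j _ => hx j)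
  refine not_weaklyIsolated_of_symmetry (i := 0) (z := x' 0 * y' 0)
    ((qubitGHZ_properties hn).1.localOp hg) one_ne_zero (fun j hj => ?_)
    (localOp_conj hg hsym) (conj_mul_self (hg 0) ?_) (conj_ne_smul_one (hg 0) fun w hw => ?_)
  · rw [hx', hy', Function.update_of_ne hj, Function.update_of_ne hj]
    exact hxy j
  · ext a b
    fin_cases a <;> fin_cases b <;> simp [Matrix.mul_apply, Fin.sum_univ_two, mul_comm]
  · have h0 := congrFun (congrFun hw 0) 1
    simp at h0
    exact hx0 h0

lemma isNonderogatory_of_ne_smul_one {B : Matrix (Fin 2) (Fin 2) ℂ}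
    (hB : ∀ c : ℂ, B ≠ c • (1 : Matrix (Fin 2) (Fin 2) ℂ)) : IsNonderogatory B := by
  intro μ
  by_contra! h
  have hle := Submodule.finrank_le (Module.End.eigenspace (Matrix.toLin' B) μ)
  rw [Module.finrank_fin_fun] at hle
  have htop : Module.End.eigenspace (Matrix.toLin' B) μ = ⊤ := by
    refine Submodule.eq_top_of_finrank_eq ?_
    rw [Module.finrank_fin_fun]
    omega
  refine hB μ (Matrix.toLin'.injective (LinearMap.ext fun v => ?_))
  have hv : v ∈ Module.End.eigenspace (Matrix.toLin' B) μ := by rw [htop]; trivial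
  rw [Module.End.mem_eigenspace_iff] at hv
  rw [hv, map_smul, Matrix.toLin'_one]
  rfl

lemma inNonderogatoryESClass_of_actAt_eq (hn : 3 ≤ n) {Φ : QState n (Fin 2)}
    (hΦ : FullyEntangled Φ) (hs : IsSymmetric Φ) {B : Matrix (Fin 2) (Fin 2) ℂ} (hB : IsUnit B)
    (hns : ∀ c : ℂ, B ≠ c • (1 : Matrix (Fin 2) (Fin 2) ℂ))
    (h : ∀ i j, actAt i B Φ = actAt j B Φ) : InNonderogatoryESClass Φ := by
  have hB' := (Matrix.isUnit_iff_isUnit_det _).1 hB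
  have h01 : (⟨0, by omega⟩ : Fin n) ≠ ⟨1, by omega⟩ := by simp
  refine ⟨Φ, ⟨fun _ => 1, fun _ => 1, fun _ => by simp, (localOp_one Φ).symm⟩, hΦ, hs, B, hB, hns,
    isNonderogatory_of_ne_smul_one hns, ⟨0, by omega⟩, ⟨1, by omega⟩, h01, ?_⟩
  generalize (⟨0, by omega⟩ : Fin n) = i at h01
  generalize (⟨1, by omega⟩ : Fin n) = j at h01
  have h1 : localOp (Function.update (Function.update (fun _ => (1 : Matrix (Fin 2) (Fin 2) ℂ)) i B)
      j B⁻¹) Φ = actAt j B⁻¹ (actAt i B Φ) := by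
    rw [actAt, actAt, localOp_localOp]
    congr 1
    ext1 o
    by_cases ho : o = j
    · subst ho; simp [h01.symm]
    · simp [ho]
  rw [h1, h i j, actAt, actAt, localOp_localOp]
  conv_rhs => rw [← localOp_one Φ]
  congr 1
  ext1 o
  by_cases ho : o = j
  · subst ho; simp [Matrix.nonsing_inv_mul _ hB']
  · simp [ho]

lemma inNonderogatoryESClass_qubitW (hn : 3 ≤ n) : InNonderogatoryESClass (qubitW n) := by
  obtain ⟨hFE, hs, -⟩ := qubitW_properties hn
  refine inNonderogatoryESClass_of_actAt_eq hn hFE hs (B := !![1, 1; 0, 1]) ?_ (fun c hc => ?_) ?_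
  · rw [Matrix.isUnit_iff_isUnit_det, Matrix.det_fin_two]
    simp
  · have := congrFun (congrFun hc 0) 1
    simp at this
  · have key : ∀ i, actAt i !![1, 1; 0, 1] (qubitW n) = qubitW n + Pi.single 0 1 := by
      intro i
      have h1 := localOp_triangular_qubitW (n := n) (Pi.single i 1) 1
      rw [one_smul, Finset.sum_pi_single', if_pos (Finset.mem_univ i), one_smul] at h1
      rw [← h1, actAt]
      congr 1
      ext1 j
      by_cases hj : j = i
      · subst hj; simp
      · simp [hj, Matrix.one_fin_two]
    intro i j
    rw [key, key]

lemma inNonderogatoryESClass_qubitGHZ (hn : 3 ≤ n) : InNonderogatoryESClass (qubitGHZ n) := by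
  obtain ⟨hFE, hs, -⟩ := qubitGHZ_properties hn
  refine inNonderogatoryESClass_of_actAt_eq hn hFE hs (B := !![1, 0; 0, 2]) ?_ (fun c hc => ?_) ?_
  · rw [Matrix.isUnit_iff_isUnit_det, Matrix.det_fin_two]
    simp
  · have h0 := congrFun (congrFun hc 0) 0
    have h1 := congrFun (congrFun hc 1) 1
    simp at h0 h1
    rw [← h0] at h1
    norm_num at h1
  · have key : ∀ i, actAt i !![1, 0; 0, 2] (qubitGHZ n) =
        Pi.single (fun _ => 0) 1 + (2 : ℂ) • Pi.single (fun _ => 1) 1 := by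
      intro i
      have h1 := localOp_diagonal_qubitGHZ (n := n) (fun _ => 1) (Function.update (fun _ => 1) i 2)
      rw [Finset.prod_const_one, one_smul, Finset.prod_update_of_mem (Finset.mem_univ i),
        Finset.prod_const_one, mul_one] at h1
      rw [← h1, actAt]
      congr 1
      ext1 j
      by_cases hj : j = i
      · subst hj; simp
      · simp [hj, Matrix.one_fin_two]
    intro i j
    rw [key, key]

end QubitClasses

lemma card_blocks {K : ℕ} (k : Fin K → ℕ) :
    Fintype.card (Σ b, Fin (k b + 1)) = K + ∑ b, k b := by
  rw [Fintype.card_sigma]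
  simp [Finset.sum_add_distrib, add_comm]

end MultipartiteLOCC

end

theorem theorem11 (n : ℕ) (hn : 3 ≤ n) :
    (∀ (K : ℕ) (k : Fin K → ℕ), 2 ≤ K → (∃ b, k b ≠ 0) →
      (∃ Φ : QState n (Σ b, Fin (k b + 1)),
        SLOCCEquivalent Φ (blockState n k) ∧ WeaklyIsolated Φ) ∧
      ((∀ b, k b ≠ 2) → ∃ Φ : QState n (Σ b, Fin (k b + 1)),
        SLOCCEquivalent Φ (blockState n k) ∧ IsSymmetric Φ ∧ WeaklyIsolated Φ)) ∧
    (InNonderogatoryESClass (qubitGHZ n) ∧ InNonderogatoryESClass (qubitW n)) ∧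
    (∀ (d : ℕ) (Ψ : QState n (Fin d)), InNonderogatoryESClass Ψ →
      ((∀ Φ : QState n (Fin d), SLOCCEquivalent Φ Ψ → ¬ WeaklyIsolated Φ) ↔
        (SLOCCEquivalent Ψ (qubitGHZ n) ∨ SLOCCEquivalent Ψ (qubitW n)))) := by
  have : NeZero n := ⟨by omega⟩
  refine ⟨fun K k hK hk => ?_,
    ⟨inNonderogatoryESClass_qubitGHZ hn, inNonderogatoryESClass_qubitW hn⟩,
    fun d Ψ hΨ => ⟨fun h => ?_, ?_⟩⟩
  · have hcard : 3 ≤ Fintype.card (Σ b, Fin (k b + 1)) := by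
      obtain ⟨b, hb⟩ := hk
      have := Finset.single_le_sum (f := k) (fun _ _ => Nat.zero_le _) (Finset.mem_univ b)
      rw [card_blocks]
      omega
    obtain ⟨Φ, h1, h2, h3⟩ := exists_symmetric_weaklyIsolated hn k hK hcard (Equiv.refl _)
    exact ⟨⟨Φ, h1, h3⟩, fun _ => ⟨Φ, h1, h2, h3⟩⟩
  · obtain ⟨Φ, hΦΨ, hFE, hsymm, B, hB, hns, hnd, i, j, hij, hstab⟩ := hΨ
    obtain ⟨K, k, hΦk⟩ := exists_sloccEquivalent_blockState hFE hsymm hB hnd hij hstab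
    have hΨk := hΦΨ.symm.trans hΦk
    have hd := hΨk.card_eq
    let e : Fin d ≃ Σ b, Fin (k b + 1) := Fintype.equivOfCardEq hd
    have hno : ∀ X : QState n (Fin d), SLOCCEquivalent X (blockState n k) → ¬ WeaklyIsolated X :=
      fun X hX => h X (hX.trans hΨk.symm)
    rw [Fintype.card_fin, card_blocks] at hd
    by_cases hK : 2 ≤ K
    · by_cases h3 : 3 ≤ K + ∑ b, k b
      · obtain ⟨X, h1, -, h2⟩ := exists_symmetric_weaklyIsolated hn k hK
          (by rwa [card_blocks]) e
        exact absurd h2 (hno X h1)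
      · left
        obtain rfl : K = 2 := by omega
        have hk : k = fun _ => 0 := by
          have h4 : ∑ b, k b = 0 := by omega
          ext b
          exact Finset.sum_eq_zero_iff.1 h4 b (Finset.mem_univ b)
        subst hk
        exact hΨk.trans (qubitGHZ_properties hn).2.2.symm
    · obtain rfl | rfl : K = 0 ∨ K = 1 := by omega
      · exfalso
        simp at hd
        subst hd
        exact hns 0 (Subsingleton.elim _ _)
      · rw [Fin.sum_univ_one] at hd
        by_cases hk2 : 2 ≤ k 0
        · obtain ⟨X, h1, h2⟩ := exists_weaklyIsolated_single hn k hk2 e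
          exact absurd h2 (hno X h1)
        by_cases hk0 : k 0 = 0
        · exfalso
          obtain rfl : d = 1 := by omega
          refine hns (B 0 0) ?_
          ext a b
          obtain rfl : a = 0 := Subsingleton.elim _ _
          obtain rfl : b = 0 := Subsingleton.elim _ _
          simp
        · right
          have hk : k = fun _ => 1 := by
            ext b
            obtain rfl : b = 0 := Subsingleton.elim _ _
            omega
          subst hk
          exact hΨk.trans (qubitW_properties hn).2.2.symm
  · rintro (h | h) Φ hΦ
    · have hd := h.card_eq
      simp only [Fintype.card_fin] at hd
      subst hd
      exact not_weaklyIsolated_of_qubitGHZ hn (hΦ.trans h)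
    · have hd := h.card_eq
      simp only [Fintype.card_fin] at hd
      subst hd
      exact not_weaklyIsolated_of_qubitW hn (hΦ.trans h)
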